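/- Let $J^k=J^k(\mathbb R^4)$ be the space of $k$-jets of functions $u(x^1,x^2,x^3,x^4)$, $(x,y,z,t)=(x^1,x^2,x^3,x^4)$, with coordinates $x^i,u,u_i$ (and $u_{ij}$, if $k=2$). For $f\in C^\infty(J^1)$ let $X_f=-\sum f_{u_i}\partial_{x^i}+(f-\sum u_if_{u_i})\partial_u+\sum(f_{x^i}+u_if_u)\partial_{u_i}$ be the contact vector field with generating function $f$, and $\hat X_f$ its prolongation to $J^2$. Consider the equations $\mathcal E$: (O) $u_{11}-u_{22}-u_{33}-u_{44}=0$; (N) $u_{24}-u_{13}+u_{11}u_{22}-u_{12}^2=0$; (D) $u_{14}u_{23}-u_{13}u_{24}=1$; (III) $u_{24}=u_{14}u_{33}-u_{13}u_{34}$; (II) $u_{14}=u_{13}u_{24}-u_{12}u_{34}$; (I) $\alpha u_{12}u_{34}+\beta u_{13}u_{24}-(\alpha+\beta)u_{14}u_{23}=0$ with $\alpha,\beta,\alpha+\beta\ne0$. Let $\mathfrak s_\infty$ be the space of the following generating functions, where $A,A_i,B,B_i,C,C_i,D$ are arbitrary smooth functions on $\mathbb R^2$ of the indicated arguments, with subscripts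 denoting partial derivatives: (O) $\varphi(x^1,\dots,x^4)$ with $\varphi$ a smooth solution of (O) on $\mathbb R^4$; (N) $A_{0t}u_z-A_{0z}u_t+(A_{0tt}x+A_{0tz}y)u_y-(A_{0tz}x+A_{0zz}y)u_x-\frac16\nabla^3A_0+A_{1t}u_y-A_{1z}u_x-\frac12\nabla^2A_1+\nabla A_2+A_3$, $A_i=A_i(t,z)$, $\nabla=x\partial_t+y\partial_z$; (D) $A_{0x}u_y-A_{0y}u_x+A_1+B_{0t}u_z-B_{0z}u_t+B_1$, $A_i=A_i(x,y)$, $B_i=B_i(t,z)$; (III) $A_{0y}u_x-A_{0x}u_y+\frac12(A_{0yy}z^2-2A_{0xy}zu_z+A_{0xx}u_z^2)+A_{1y}z-A_{1x}u_z+A_2+B_0$, $A_i=A_i(x,y)$, $B_0=B_0(t,u_t)$; (II) $A_{0z}u_y-A_{0y}u_z+A_1+B_0+C_0$, $A_i=A_i(y,z)$, $B_0=B_0(x,u_x)$, $C_0=C_0(t,u_t)$; (I) $A(x,u_x)+B(y,u_y)+C(z,u_z)+D(t,u_t)$. A differential invariant of $\mathfrak s_\infty$ on an open set $U\subseteq J^k$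 is a smooth function on $U$ annihilated by (the prolongations of) all $X_f$, $f\in\mathfrak s_\infty$. Put $$I_{\rm O}=u_{11}-u_{22}-u_{33}-u_{44},\quad I_{\rm N}=u_{24}-u_{13}+u_{11}u_{22}-u_{12}^2,\quad I_{\rm D}=u_{14}u_{23}-u_{13}u_{24},$$ $$I_{\rm III}=\frac{u_{24}-u_{14}u_{33}+u_{13}u_{34}}{u_{34}},\quad I_{\rm II}=\frac{u_{13}u_{24}-u_{12}u_{34}}{u_{14}},\quad I_{\rm I}=\frac{u_{12}u_{34}-u_{13}u_{24}}{u_{12}u_{34}-u_{14}u_{23}}.$$ Let $\Omega\subseteq J^2$ be the set where the denominator of $I$ does not vanish. Then: 1. In the cases N, D, III, II, I every differential invariant on a connected open subset of $J^1$ is constant. In the case O the functions $x^i$ are invariants, and every differential invariant on an open subset of $J^1$ is locally a smooth function of $x^1,\dots,x^4$. 2. $I$ is a differential invariant on $\Omega$, and the set of the points of $\Omega$ with $dI\ne0$ is dense in $J^2$. In the cases N, D, III, II, I every differential invariant $J$ on an open subset of $J^2$ has near each point of its domain that lies in $\Omega$ and where $dI\neq0$ the form $J=F(I)$ with $F$ smooth;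 in the case O it has near each point of its domain the form $J=F(x^1,\dots,x^4,I_{\rm O})$ with $F$ smooth. 3. (Each equation is recovered from its symmetry algebra.) In the cases N, D, III, II, I, every smooth hypersurface of an open subset of $J^2$ to which all $\hat X_f$, $f\in\mathfrak s_\infty$, are tangent coincides, near each of its points that lies in $\Omega$ and where $dI\ne0$, with a level set $I=c$. In all cases except I, the level set $I=c$ in $\Omega$ is equivalent to $\mathcal E\cap\Omega$ by a diffeomorphism of $J^2$ preserving the Cartan distribution, for every $c\in\mathbb R$ in the cases O, N, III and every $c\neq0$ in the cases D, II; in the case I, $\mathcal E\cap\Omega=\{I=(\alpha+\beta)/\beta\}$. In all six cases $\mathfrak s_\infty$ is contained in the algebra $\mathfrak g$ of all contact symmetries of $\mathcal E$, $\mathcal E\cap\Omega$ is dense in $\mathcal E$, and $\mathcal E$ is Lie remarkable: every smooth hypersurface of an open subset of $J^2$ that is $\mathfrak g$-invariant and passes through a point of $\mathcal E\cap\Omega$ coincides with $\mathcal E$ near that point. In the cases N, D, III, II, I the same holds with $\mathfrak s_\infty$ in place of $\mathfrak g$. -/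

import Mathlib

open scoped ContDiff Topology

noncomputable section

namespace MongeAmpere

/-! Jets of scalar functions `u(x¹,x²,x³,x⁴)`. The coordinates `(x¹,x²,x³,x⁴) = (x,y,z,t)` are indexed
by `0, 1, 2, 3 : Fin 4`. -/

/-- The jet space `J¹(ℝ⁴)` with coordinates `(xⁱ, u, uᵢ)`. -/
abbrev J1 : Type := (Fin 4 → ℝ) × ℝ × (Fin 4 → ℝ)

/-- The jet space `J²(ℝ⁴)` with coordinates `(xⁱ, u, uᵢ)` and `uᵢⱼ = uⱼᵢ`. -/
abbrev J2 : Type := J1 × (Sym2 (Fin 4) → ℝ)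

/-- The second order coordinate `uᵢⱼ` on `J²`. -/
def hess (θ : J2) (i j : Fin 4) : ℝ := θ.2 s(i, j)

/-- The vector `∂ᵢ + uᵢ ∂ᵤ + ∑ₖ uᵢₖ ∂_{uₖ}` tangent to `J¹`. -/
def dir (i : Fin 4) (θ : J2) : J1 :=
  (Pi.single i 1, θ.1.2.2 i, fun k => hess θ i k)

/-- The total derivative `Dᵢ g`, a function on `J²`, of a function `g` on `J¹`. -/
def totalD (i : Fin 4) (g : J1 → ℝ) (θ : J2) : ℝ := fderiv ℝ g θ.1 (dir i θ)

/-- The truncated second total derivative `Dᵢ Dⱼ g - ∑ₖ uᵢⱼₖ g_{uₖ}`, a function on `J²`: the second order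
coordinates are kept constant in the outer differentiation. -/
def totalD2 (i j : Fin 4) (g : J1 → ℝ) (θ : J2) : ℝ :=
  totalD i (fun ϑ : J1 => totalD j g (ϑ, θ.2)) θ

/-- The partial derivative of `f` by `uᵢ`. -/
def dP (i : Fin 4) (f : J1 → ℝ) (θ : J1) : ℝ := fderiv ℝ f θ (0, 0, Pi.single i 1)

/-- The contact vector field on `J¹` with generating function `f`:
`X_f = -∑ f_{uᵢ} ∂ᵢ + (f - ∑ uᵢ f_{uᵢ}) ∂ᵤ + ∑ (f_{xⁱ} + uᵢ f_u) ∂_{uᵢ}`. -/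
def contactField (f : J1 → ℝ) (θ : J1) : J1 :=
  (fun i => - dP i f θ,
   f θ - ∑ i, θ.2.2 i * dP i f θ,
   fun i => fderiv ℝ f θ (Pi.single i 1, θ.2.2 i, 0))

/-- The prolongation of `X_f` to `J²`. Its components along the fibres of `J² → J¹` are
`Dᵢ Dⱼ f - ∑ₖ uᵢⱼₖ f_{uₖ}` for `i ≤ j`. -/
def prolong (f : J1 → ℝ) (θ : J2) : J2 :=
  (contactField f θ.1, fun s => totalD2 s.inf s.sup f θ)

/-- `I` is a (smooth) differential invariant on `U ⊆ J¹` of the algebra of contact fields with generating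
functions in `s`. -/
def IsInvariant1 (s : Set (J1 → ℝ)) (U : Set J1) (I : J1 → ℝ) : Prop :=
  ContDiffOn ℝ ∞ I U ∧ ∀ f ∈ s, ∀ θ ∈ U, fderiv ℝ I θ (contactField f θ) = 0

/-- `I` is a (smooth) differential invariant on `U ⊆ J²` of the algebra of contact fields with generating
functions in `s`. -/
def IsInvariant2 (s : Set (J1 → ℝ)) (U : Set J2) (I : J2 → ℝ) : Prop :=
  ContDiffOn ℝ ∞ I U ∧ ∀ f ∈ s, ∀ θ ∈ U, fderiv ℝ I θ (prolong f θ) = 0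

/-- The equation `G = 0` in `U ⊆ J²` is a smooth hypersurface and admits all contact fields with generating
functions in `s` as infinitesimal symmetries. -/
def IsInvariantEquation (s : Set (J1 → ℝ)) (U : Set J2) (G : J2 → ℝ) : Prop :=
  ContDiffOn ℝ ∞ G U ∧ ∀ θ ∈ U, G θ = 0 →
    fderiv ℝ G θ ≠ 0 ∧ ∀ f ∈ s, fderiv ℝ G θ (prolong f θ) = 0

/-- The contact symmetry algebra of the equation `F = 0` (as a set of generating functions). -/
def contactSymmetries (F : J2 → ℝ) : Set (J1 → ℝ) :=
  {f | ContDiff ℝ ∞ f ∧ ∀ θ, F θ = 0 → fderiv ℝ F θ (prolong f θ) = 0}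

/-- Near every point of `E ∩ W`, the set `E` is the only `s`-invariant second order scalar equation passing
through that point. -/
def IsRecoveredFrom (E W : Set J2) (s : Set (J1 → ℝ)) : Prop :=
  ∀ (U : Set J2) (G : J2 → ℝ), IsOpen U → IsInvariantEquation s U G →
    ∀ θ ∈ U ∩ (E ∩ W), G θ = 0 → ∀ᶠ θ' in 𝓝 θ, (G θ' = 0 ↔ θ' ∈ E)

/-- The Cartan (higher contact) distribution on `J²`, spanned by the truncated total derivatives and the
vectors tangent to the fibres of `J² → J¹`. -/
def cartan (θ : J2) : Set J2 := {v | ∃ a : Fin 4 → ℝ, v.1 = ∑ i, a i • dir i θ}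

/-- Two subsets of `J²` are contact equivalent if a diffeomorphism of `J²` that preserves the Cartan
distribution maps one onto the other. -/
def ContactEquivalent (E E' : Set J2) : Prop :=
  ∃ Φ : J2 ≃ J2, ContDiff ℝ ∞ Φ ∧ ContDiff ℝ ∞ Φ.symm ∧
    (∀ θ v, v ∈ cartan θ ↔ fderiv ℝ Φ θ v ∈ cartan (Φ θ)) ∧ Φ '' E = E'

/-- The six types of integrable Monge-Ampère equations of Hirota type in 4D. -/
inductive MAType : Type
  | O | N | D | III | II | I

/-- The left hand side `F` of the equation `F = 0` of the given type; `α`, `β` are only used in type I. -/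
def equationFn (α β : ℝ) : MAType → J2 → ℝ
  | .O, θ => hess θ 0 0 - hess θ 1 1 - hess θ 2 2 - hess θ 3 3
  | .N, θ => hess θ 1 3 - hess θ 0 2 + hess θ 0 0 * hess θ 1 1 - hess θ 0 1 ^ 2
  | .D, θ => hess θ 0 3 * hess θ 1 2 - hess θ 0 2 * hess θ 1 3 - 1
  | .III, θ => hess θ 1 3 - (hess θ 0 3 * hess θ 2 2 - hess θ 0 2 * hess θ 2 3)
  | .II, θ => hess θ 0 3 - (hess θ 0 2 * hess θ 1 3 - hess θ 0 1 * hess θ 2 3)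
  | .I, θ => α * (hess θ 0 1 * hess θ 2 3) + β * (hess θ 0 2 * hess θ 1 3)
      - (α + β) * (hess θ 0 3 * hess θ 1 2)

/-- The equation of the given type, as a subset of `J²`. -/
def equation (α β : ℝ) (τ : MAType) : Set J2 := {θ | equationFn α β τ θ = 0}

/-- The numerator of the second order invariant. -/
def invNum : MAType → J2 → ℝ
  | .O, θ => hess θ 0 0 - hess θ 1 1 - hess θ 2 2 - hess θ 3 3
  | .N, θ => hess θ 1 3 - hess θ 0 2 + hess θ 0 0 * hess θ 1 1 - hess θ 0 1 ^ 2
  | .D, θ => hess θ 0 3 * hess θ 1 2 - hess θ 0 2 * hess θ 1 3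
  | .III, θ => hess θ 1 3 - hess θ 0 3 * hess θ 2 2 + hess θ 0 2 * hess θ 2 3
  | .II, θ => hess θ 0 2 * hess θ 1 3 - hess θ 0 1 * hess θ 2 3
  | .I, θ => hess θ 0 1 * hess θ 2 3 - hess θ 0 2 * hess θ 1 3

/-- The denominator of the second order invariant. -/
def invDen : MAType → J2 → ℝ
  | .O, _ => 1
  | .N, _ => 1
  | .D, _ => 1
  | .III, θ => hess θ 2 3
  | .II, θ => hess θ 0 3
  | .I, θ => hess θ 0 1 * hess θ 2 3 - hess θ 0 3 * hess θ 1 2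

/-- The second order invariant of the given type. -/
def inv (τ : MAType) (θ : J2) : ℝ := invNum τ θ / invDen τ θ

/-- The domain of definition of the invariant. -/
def dom (τ : MAType) : Set J2 := {θ | invDen τ θ ≠ 0}

/-- The regular points of the invariant. -/
def reg (τ : MAType) : Set J2 := {θ | θ ∈ dom τ ∧ fderiv ℝ (inv τ) θ ≠ 0}

/-- The level set `I = c` of the invariant. -/
def level (τ : MAType) (c : ℝ) : Set J2 := {θ | θ ∈ dom τ ∧ inv τ θ = c}

/-! Generating functions of the infinite parts of the symmetry algebras, parametrized by functions on the
plane `M = ℝ²(p,q)`. -/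

/-- The partial derivative by the first variable of the plane. -/
def d₁ (A : ℝ × ℝ → ℝ) (m : ℝ × ℝ) : ℝ := fderiv ℝ A m (1, 0)

/-- The partial derivative by the second variable of the plane. -/
def d₂ (A : ℝ × ℝ → ℝ) (m : ℝ × ℝ) : ℝ := fderiv ℝ A m (0, 1)

/-- The operator `∇ = x ∂_t + y ∂_z` on functions `A(t,z)`, at fixed `x`, `y`. -/
def nabla (x y : ℝ) (A : ℝ × ℝ → ℝ) (m : ℝ × ℝ) : ℝ := x * d₁ A m + y * d₂ A m

/-- Type N, all functions on `ℝ²(t,z)`. -/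
def genN (A₀ A₁ A₂ A₃ : ℝ × ℝ → ℝ) : J1 → ℝ := fun θ =>
  let x := θ.1 0
  let y := θ.1 1
  let m : ℝ × ℝ := (θ.1 3, θ.1 2)
  let ux := θ.2.2 0
  let uy := θ.2.2 1
  let uz := θ.2.2 2
  let ut := θ.2.2 3
  (d₁ A₀ m * uz - d₂ A₀ m * ut + (d₁ (d₁ A₀) m * x + d₁ (d₂ A₀) m * y) * uy
      - (d₁ (d₂ A₀) m * x + d₂ (d₂ A₀) m * y) * ux
      - 1 / 6 * nabla x y (nabla x y (nabla x y A₀)) m)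
    + (d₁ A₁ m * uy - d₂ A₁ m * ux - 1 / 2 * nabla x y (nabla x y A₁) m)
    + nabla x y A₂ m
    + A₃ m

/-- Type D, `A₀`, `A₁` functions on `ℝ²(x,y)` and `B₀`, `B₁` functions on `ℝ²(t,z)`. -/
def genD (A₀ A₁ B₀ B₁ : ℝ × ℝ → ℝ) : J1 → ℝ := fun θ =>
  let m : ℝ × ℝ := (θ.1 0, θ.1 1)
  let n : ℝ × ℝ := (θ.1 3, θ.1 2)
  let ux := θ.2.2 0
  let uy := θ.2.2 1
  let uz := θ.2.2 2
  let ut := θ.2.2 3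
  (d₁ A₀ m * uy - d₂ A₀ m * ux) + A₁ m + (d₁ B₀ n * uz - d₂ B₀ n * ut) + B₁ n

/-- Type III, `A₀`, `A₁`, `A₂` functions on `ℝ²(x,y)` and `B₀` a function on `ℝ²(t,u_t)`. -/
def genIII (A₀ A₁ A₂ B₀ : ℝ × ℝ → ℝ) : J1 → ℝ := fun θ =>
  let z := θ.1 2
  let m : ℝ × ℝ := (θ.1 0, θ.1 1)
  let ux := θ.2.2 0
  let uy := θ.2.2 1
  let uz := θ.2.2 2
  (d₂ A₀ m * ux - d₁ A₀ m * uy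
      + 1 / 2 * (d₂ (d₂ A₀) m * z ^ 2 - 2 * d₁ (d₂ A₀) m * z * uz + d₁ (d₁ A₀) m * uz ^ 2))
    + (d₂ A₁ m * z - d₁ A₁ m * uz)
    + A₂ m
    + B₀ (θ.1 3, θ.2.2 3)

/-- Type II, `A₀`, `A₁` functions on `ℝ²(y,z)`, `B₀` a function on `ℝ²(x,u_x)`, `C₀` one on `ℝ²(t,u_t)`. -/
def genII (A₀ A₁ B₀ C₀ : ℝ × ℝ → ℝ) : J1 → ℝ := fun θ =>
  let m : ℝ × ℝ := (θ.1 1, θ.1 2)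
  let uy := θ.2.2 1
  let uz := θ.2.2 2
  (d₂ A₀ m * uy - d₁ A₀ m * uz) + A₁ m + B₀ (θ.1 0, θ.2.2 0) + C₀ (θ.1 3, θ.2.2 3)

/-- Type I, functions on `ℝ²(x,u_x)`, `ℝ²(y,u_y)`, `ℝ²(z,u_z)`, `ℝ²(t,u_t)`. -/
def genI (A B C D : ℝ × ℝ → ℝ) : J1 → ℝ := fun θ =>
  A (θ.1 0, θ.2.2 0) + B (θ.1 1, θ.2.2 1) + C (θ.1 2, θ.2.2 2) + D (θ.1 3, θ.2.2 3)

/-- Smooth functions on the plane. -/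
def Smooth (A : ℝ × ℝ → ℝ) : Prop := ContDiff ℝ ∞ A

/-- The second partial derivative by `xⁱ` of a function on `ℝ⁴`. -/
def secondPartial (i : Fin 4) (φ : (Fin 4 → ℝ) → ℝ) (x : Fin 4 → ℝ) : ℝ :=
  fderiv ℝ (fun y => fderiv ℝ φ y (Pi.single i 1)) x (Pi.single i 1)

/-- The smooth solutions of the linear wave equation `φ₁₁ - φ₂₂ - φ₃₃ - φ₄₄ = 0`. -/
def IsWave (φ : (Fin 4 → ℝ) → ℝ) : Prop :=
  ContDiff ℝ ∞ φ ∧ ∀ x, secondPartial 0 φ x - secondPartial 1 φ x - secondPartial 2 φ x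
    - secondPartial 3 φ x = 0

/-- The infinite part of the contact symmetry algebra (as a set of generating functions). -/
def sInf : MAType → Set (J1 → ℝ)
  | .O => {f | ∃ φ, IsWave φ ∧ f = fun θ => φ θ.1}
  | .N => {f | ∃ A B C D, Smooth A ∧ Smooth B ∧ Smooth C ∧ Smooth D ∧ f = genN A B C D}
  | .D => {f | ∃ A B C D, Smooth A ∧ Smooth B ∧ Smooth C ∧ Smooth D ∧ f = genD A B C D}
  | .III => {f | ∃ A B C D, Smooth A ∧ Smooth B ∧ Smooth C ∧ Smooth D ∧ f = genIII A B C D}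
  | .II => {f | ∃ A B C D, Smooth A ∧ Smooth B ∧ Smooth C ∧ Smooth D ∧ f = genII A B C D}
  | .I => {f | ∃ A B C D, Smooth A ∧ Smooth B ∧ Smooth C ∧ Smooth D ∧ f = genI A B C D}

end MongeAmpere

end

/-! All claims except density and the contact equivalences come from one pointwise fact
(`eq_zero_of_prolong`): outside type O, at a regular point of I, the prolonged fields of `sInf` span
exactly the kernel of dI.

They lie in the kernel because I is a quotient whose numerator and denominator are multiplied by the
same infinitesimal factor under each field (`exists_scale`). That they fill it is shown by duality.
A linear form on the tangent space that kills all prolonged fields is tested on generating functions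
whose parameters are polynomials of degree at most two centred at the point. Most tests kill one
coefficient each. The others give linear relations between the surviving coefficients and the uᵢⱼ,
and these force the form to vanish on ker dI. Types D and II reduce to a statement on 2×2 matrices
(`eq_smul_cofactor`), type I to the vanishing of all minors of two coefficient vectors
(`proportional_of_relations`).

The rest is calculus. If dJ vanishes on ker dI, then J is locally a function of I (`exists_factor`).
If a regular hypersurface is tangent to ker dI, it is locally a level set of I
(`eventually_zero_iff_level`). Since I involves only the uᵢⱼ, ker dI projects onto the whole tangent
space of J¹, so there are no invariants of first order.

In type O the fields of `sInf` do not move the xⁱ, which are therefore additional invariants. The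
contact symmetries uᵢ, which are translations, supply the missing directions when the full symmetry
algebra is used.

Each equation is a fixed linear combination of numerator and denominator, hence a level set of I in
`dom`. All points of this level set are regular, because its value of I is not a critical one
(`mem_reg_of_mem_equation`). Levels are moved to the equation by adding a quadratic form to u, which
shifts I, or by scaling one coordinate, which scales I. -/

noncomputable section

namespace MongeAmpere

/-! ### Functions and hypersurfaces constant along the kernel of a differential. -/

section Analysis

variable {E V : Type*} [NormedAddCommGroup E] [NormedSpace ℝ E]
  [NormedAddCommGroup V] [NormedSpace ℝ V]

lemma exists_segment_sub_eq_fderiv {J : E → ℝ} {s : Set E} (ho : IsOpen s)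
    (hJ : DifferentiableOn ℝ J s) {x y : E} (hxy : segment ℝ x y ⊆ s) :
    ∃ z ∈ segment ℝ x y, J y - J x = fderiv ℝ J z (y - x) :=
  domain_mvt (f' := fun z => fderiv ℝ J z)
    (fun z hz => ((hJ z (hxy hz)).differentiableAt
      (ho.mem_nhds (hxy hz))).hasFDerivAt.hasFDerivWithinAt)
    (convex_segment x y) (left_mem_segment ℝ x y) (right_mem_segment ℝ x y)

/-- A function that is constant along the kernel of a linear map `L` with a right inverse `R` is locally
a smooth function of `L`. -/
theorem exists_factor_linear [FiniteDimensional ℝ V] (L : E →L[ℝ] V) (R : V →L[ℝ] E)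
    (hLR : ∀ c, L (R c) = c) {U : Set E} (hU : IsOpen U) {J : E → ℝ} (hJ : ContDiffOn ℝ ∞ J U)
    (hker : ∀ y ∈ U, ∀ v, L v = 0 → fderiv ℝ J y v = 0) {a : E} (ha : a ∈ U) :
    ∃ F : V → ℝ, ContDiff ℝ ∞ F ∧ ∀ᶠ y in 𝓝 a, J y = F (L y) := by
  obtain ⟨r, hr, hball⟩ := Metric.isOpen_iff.1 hU a ha
  -- The affine section of L through a. The factor is J ∘ S, cut off by a bump function so that it
  -- is smooth on all of V.
  set S : V → E := fun c => a + R (c - L a) with hS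
  have hScd : ContDiff ℝ ∞ S := by fun_prop
  have hSa : S (L a) = a := by simp [hS]
  have hW : S ⁻¹' Metric.ball a r ∈ 𝓝 (L a) := by
    apply hScd.continuous.continuousAt.preimage_mem_nhds
    rw [hSa]
    exact Metric.ball_mem_nhds a hr
  obtain ⟨W', hW'sub, hW'o, hW'a⟩ := mem_nhds_iff.1 hW
  obtain ⟨d, hd, hdsub⟩ := Euclidean.nhds_basis_closedBall.mem_iff.1 hW
  let b : ContDiffBump (toEuclidean (L a)) :=
    { rIn := d / 2, rOut := d, rIn_pos := half_pos hd, rIn_lt_rOut := half_lt_self hd }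
  let χ : V → ℝ := fun x => b (toEuclidean x)
  have hχ : ContDiff ℝ ∞ χ := b.contDiff.comp (toEuclidean (E := V)).contDiff
  have hχ1 : ∀ᶠ x in 𝓝 (L a), χ x = 1 :=
    (toEuclidean (E := V)).continuous.continuousAt.eventually b.eventuallyEq_one
  have hχs : tsupport χ ⊆ S ⁻¹' Metric.ball a r := by
    refine (closure_mono ?_).trans ((Euclidean.isClosed_closedBall).closure_eq.subset.trans hdsub)
    intro x hx
    by_contra hx'
    apply hx
    apply b.zero_of_le_dist
    exact (not_le.1 hx').le
  have hSU : ∀ c, S c ∈ Metric.ball a r → ContDiffAt ℝ ∞ (fun c => J (S c)) c := fun c hc =>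
    ((hJ _ (hball hc)).contDiffAt (hU.mem_nhds (hball hc))).comp c hScd.contDiffAt
  refine ⟨fun c => χ c * J (S c), ?_, ?_⟩
  · refine contDiff_iff_contDiffAt.2 fun x => ?_
    by_cases hx : x ∈ tsupport χ
    · exact hχ.contDiffAt.mul (hSU x (hχs hx))
    · refine (contDiffAt_const (c := 0)).congr_of_eventuallyEq ?_
      filter_upwards [notMem_tsupport_iff_eventuallyEq.1 hx] with y hy
      simp [hy]
  · have h1 : ∀ᶠ y in 𝓝 a, χ (L y) = 1 := L.continuous.continuousAt.eventually hχ1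
    have h2 : ∀ᶠ y in 𝓝 a, S (L y) ∈ Metric.ball a r :=
      L.continuous.continuousAt.preimage_mem_nhds hW
    filter_upwards [h1, h2, Metric.ball_mem_nhds a hr] with y hy1 hy2 hy3
    -- The points y and S (L y) differ by an element of ker L, so the mean value theorem gives J y =
    -- J (S (L y)).
    have hseg := (convex_ball a r).segment_subset hy2 hy3
    obtain ⟨z, hz, hzeq⟩ := exists_segment_sub_eq_fderiv hU
      (hJ.differentiableOn (by simp)) (hseg.trans hball)
    rw [hker z (hball (hseg hz)) _ (by simp [hS, hLR])] at hzeq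
    rw [hy1, one_mul]
    linarith

/-- A regular function becomes affine in suitable local coordinates. -/
theorem exists_straightening [CompleteSpace E] {U : Set E} (hU : IsOpen U) {G : E → ℝ}
    (hG : ContDiffOn ℝ ∞ G U) {a : E} (ha : a ∈ U) (h : fderiv ℝ G a ≠ 0) :
    ∃ Ψ : OpenPartialHomeomorph E E, a ∈ Ψ.source ∧ Ψ.source ⊆ U ∧ Ψ a = a ∧
      ContDiffOn ℝ ∞ Ψ.symm Ψ.target ∧
      ∀ x ∈ Ψ.source, G x = G a + fderiv ℝ G a (Ψ x - a) := by
  set L := fderiv ℝ G a with hL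
  obtain ⟨w, hw⟩ : ∃ w, L w = 1 := by
    obtain ⟨v, hv⟩ : ∃ v, L v ≠ 0 := by
      by_contra! hcon
      exact h (ContinuousLinearMap.ext hcon)
    exact ⟨(L v)⁻¹ • v, by simp [hv]⟩
  -- Since L w = 1, L (ψ x - a) = G x - G a. The correction term vanishes to first order at a, so ψ
  -- has derivative the identity there.
  let ψ : E → E := fun x => x + (G x - G a - L (x - a)) • w
  have hψ : ContDiffOn ℝ ∞ ψ U :=
    contDiffOn_id.add (((hG.sub contDiffOn_const).sub (by fun_prop)).smul contDiffOn_const)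
  have hψa : ψ a = a := by simp [ψ]
  have hGa : HasFDerivAt G L a :=
    ((hG a ha).contDiffAt (hU.mem_nhds ha)).differentiableAt (by simp) |>.hasFDerivAt
  have hψ' : HasFDerivAt ψ (ContinuousLinearEquiv.refl ℝ E : E →L[ℝ] E) a := by
    have h1 := (hasFDerivAt_id a).add
      (((hGa.sub_const (G a)).sub (L.hasFDerivAt.comp a ((hasFDerivAt_id a).sub_const a))).smul_const w)
    have h2 : (ContinuousLinearMap.id ℝ E + (L - L ∘L ContinuousLinearMap.id ℝ E).smulRight w) =
        (ContinuousLinearEquiv.refl ℝ E : E →L[ℝ] E) := by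
      ext v
      simp
    rw [← h2]
    exact h1
  have hcd : ContDiffAt ℝ ∞ ψ a := (hψ a ha).contDiffAt (hU.mem_nhds ha)
  let Φ := hcd.toOpenPartialHomeomorph ψ hψ' (by simp)
  have hcont : ContinuousOn (fderiv ℝ ψ) U := hψ.continuousOn_fderiv_of_isOpen hU (by simp)
  -- The inverse is smooth at the images of points where dψ is invertible, so the chart is
  -- restricted to the open set of these points.
  let W := U ∩ fderiv ℝ ψ ⁻¹' Set.range ((↑) : (E ≃L[ℝ] E) → E →L[ℝ] E)
  have hW : IsOpen W := hcont.isOpen_inter_preimage hU ContinuousLinearEquiv.isOpen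
  have haW : a ∈ W := ⟨ha, by rw [Set.mem_preimage, hψ'.fderiv]; exact ⟨_, rfl⟩⟩
  refine ⟨Φ.restrOpen W hW, ⟨hcd.mem_toOpenPartialHomeomorph_source hψ' (by simp), haW⟩, ?_, hψa, ?_, ?_⟩
  · exact fun x hx => hx.2.1
  · intro y hy
    apply ContDiffAt.contDiffWithinAt
    have hx := (Φ.restrOpen W hW).map_target hy
    obtain ⟨f', hf'⟩ := hx.2.2
    have hxU := hx.2.1
    have hcx : ContDiffAt ℝ ∞ ψ ((Φ.restrOpen W hW).symm y) := (hψ _ hxU).contDiffAt (hU.mem_nhds hxU)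
    refine (Φ.restrOpen W hW).contDiffAt_symm (f₀' := f') hy ?_ hcx
    rw [hf']
    exact (hcx.differentiableAt (by simp)).hasFDerivAt
  · intro x _
    change G x = G a + L (ψ x - a)
    simp only [ψ, map_sub, map_add, map_smul, hw, smul_eq_mul]
    ring

/-- If `J` is constant along the level sets of `I`, infinitesimally, then it is locally a smooth function
of `I`. -/
theorem exists_factor [CompleteSpace E] {U : Set E} (hU : IsOpen U) {I J : E → ℝ}
    (hI : ContDiffOn ℝ ∞ I U) (hJ : ContDiffOn ℝ ∞ J U)
    (hker : ∀ x ∈ U, ∀ v, fderiv ℝ I x v = 0 → fderiv ℝ J x v = 0) {a : E} (ha : a ∈ U)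
    (h : fderiv ℝ I a ≠ 0) :
    ∃ F : ℝ → ℝ, ContDiff ℝ ∞ F ∧ ∀ᶠ x in 𝓝 a, J x = F (I x) := by
  obtain ⟨Ψ, haΨ, hΨU, hΨa, hΨs, hΨI⟩ := exists_straightening hU hI ha h
  set L := fderiv ℝ I a with hL
  obtain ⟨w, hw⟩ : ∃ w, L w = 1 := by
    obtain ⟨v, hv⟩ : ∃ v, L v ≠ 0 := by
      by_contra! hcon
      exact h (ContinuousLinearMap.ext hcon)
    exact ⟨(L v)⁻¹ • v, by simp [hv]⟩
  have hmaps : ∀ y ∈ Ψ.target, Ψ.symm y ∈ U := fun y hy => hΨU (Ψ.map_target hy)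
  have hda := fun y (hy : y ∈ Ψ.target) =>
    ((hΨs y hy).contDiffAt (Ψ.open_target.mem_nhds hy)).differentiableAt (by simp)
  have hdI := fun x (hx : x ∈ U) =>
    ((hI x hx).contDiffAt (hU.mem_nhds hx)).differentiableAt (by simp)
  have hdJ := fun x (hx : x ∈ U) =>
    ((hJ x hx).contDiffAt (hU.mem_nhds hx)).differentiableAt (by simp)
  obtain ⟨F, hF, hFe⟩ := exists_factor_linear L (ContinuousLinearMap.toSpanSingleton ℝ w)
    (by simp [hw]) Ψ.open_target (J := J ∘ Ψ.symm) (hJ.comp hΨs hmaps) (by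
      intro y hy v hv
      rw [fderiv_comp y (hdJ _ (hmaps y hy)) (hda y hy)]
      refine hker _ (hmaps y hy) _ ?_
      change (fderiv ℝ I (Ψ.symm y) ∘L fderiv ℝ Ψ.symm y) v = 0
      rw [← fderiv_comp y (hdI _ (hmaps y hy)) (hda y hy)]
      -- In the straightened coordinates I is affine with linear part L, so ker L is carried to the
      -- kernel of dI.
      have : I ∘ Ψ.symm =ᶠ[𝓝 y] fun y => I a + L (y - a) := by
        filter_upwards [Ψ.open_target.mem_nhds hy] with z hz
        simp [hΨI _ (Ψ.map_target hz), Ψ.right_inv hz]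
      rw [this.fderiv_eq]
      have h2 : HasFDerivAt (fun y => I a + L (y - a)) L y := by
        simpa using (L.hasFDerivAt.comp y ((hasFDerivAt_id y).sub_const a)).const_add (I a)
      rw [h2.fderiv, hv]) (a := a) (by simpa [hΨa] using Ψ.map_source haΨ)
  refine ⟨fun c => F (c - I a + L a), hF.comp (by fun_prop), ?_⟩
  have hc : ContinuousAt Ψ a := Ψ.continuousAt haΨ
  rw [ContinuousAt, hΨa] at hc
  filter_upwards [hc.eventually hFe, Ψ.open_source.mem_nhds haΨ] with x hx hxs
  simp only [Function.comp, Ψ.left_inv hxs] at hx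
  rw [hx, hΨI x hxs]
  congr 1
  simp

/-- A hypersurface `G = 0` that is infinitesimally tangent to the level sets of `I` is locally a level set
of `I`. -/
theorem eventually_zero_iff_level [CompleteSpace E] {U : Set E} (hU : IsOpen U) {I G : E → ℝ}
    (hI : ContDiffOn ℝ ∞ I U) (hG : ContDiffOn ℝ ∞ G U)
    (hG' : ∀ x ∈ U, G x = 0 → fderiv ℝ G x ≠ 0)
    (hker : ∀ x ∈ U, G x = 0 → ∀ v, fderiv ℝ I x v = 0 → fderiv ℝ G x v = 0) {a : E} (ha : a ∈ U)
    (hGa : G a = 0) :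
    ∀ᶠ x in 𝓝 a, (G x = 0 ↔ I x = I a) := by
  -- The tangency is known only on G = 0, so G, not I, has to be straightened. There the kernels
  -- agree: if dG v = 0 and dI v ≠ 0, every u is a multiple of v plus an element of ker dI, and dG
  -- would vanish.
  have hker' : ∀ x ∈ U, G x = 0 → ∀ v, fderiv ℝ G x v = 0 → fderiv ℝ I x v = 0 := by
    intro x hx hx0 v hv
    by_contra hne
    apply hG' x hx hx0
    ext u
    have h1 := hker x hx hx0 (u - (fderiv ℝ I x u / fderiv ℝ I x v) • v)
      (by simp [hne])
    simpa [hv] using h1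
  obtain ⟨Ψ, haΨ, hΨU, hΨa, hΨs, hΨG⟩ := exists_straightening hU hG ha (hG' a ha hGa)
  have hne := hG' a ha hGa
  set L := fderiv ℝ G a with hL
  obtain ⟨w, hw⟩ : ∃ w, L w = 1 := by
    obtain ⟨v, hv⟩ : ∃ v, L v ≠ 0 := by
      by_contra! hcon
      exact hne (ContinuousLinearMap.ext hcon)
    exact ⟨(L v)⁻¹ • v, by simp [hv]⟩
  have hmaps : ∀ y ∈ Ψ.target, Ψ.symm y ∈ U := fun y hy => hΨU (Ψ.map_target hy)
  have hda := fun y (hy : y ∈ Ψ.target) =>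
    ((hΨs y hy).contDiffAt (Ψ.open_target.mem_nhds hy)).differentiableAt (by simp)
  have hdI := fun x (hx : x ∈ U) =>
    ((hI x hx).contDiffAt (hU.mem_nhds hx)).differentiableAt (by simp)
  have hdG := fun x (hx : x ∈ U) =>
    ((hG x hx).contDiffAt (hU.mem_nhds hx)).differentiableAt (by simp)
  have hGs : ∀ y ∈ Ψ.target, G (Ψ.symm y) = L (y - a) := by
    intro y hy
    rw [hΨG _ (Ψ.map_target hy), Ψ.right_inv hy, hGa, zero_add]
  have hGd : ∀ y ∈ Ψ.target, ∀ v, fderiv ℝ G (Ψ.symm y) (fderiv ℝ Ψ.symm y v) = L v := by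
    intro y hy v
    change (fderiv ℝ G (Ψ.symm y) ∘L fderiv ℝ Ψ.symm y) v = L v
    rw [← fderiv_comp y (hdG _ (hmaps y hy)) (hda y hy)]
    have : G ∘ Ψ.symm =ᶠ[𝓝 y] fun y => L (y - a) := by
      filter_upwards [Ψ.open_target.mem_nhds hy] with z hz using hGs z hz
    rw [this.fderiv_eq]
    have h2 : HasFDerivAt (fun y => L (y - a)) (L ∘L ContinuousLinearMap.id ℝ E) y :=
      L.hasFDerivAt.comp y ((hasFDerivAt_id y).sub_const a)
    rw [h2.fderiv, ContinuousLinearMap.comp_id]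
  set K : E → ℝ := I ∘ Ψ.symm with hK
  have hKc : ContDiffOn ℝ ∞ K Ψ.target := hI.comp hΨs hmaps
  have hKd : ∀ y ∈ Ψ.target, ∀ v,
      fderiv ℝ K y v = fderiv ℝ I (Ψ.symm y) (fderiv ℝ Ψ.symm y v) := by
    intro y hy v
    rw [hK, fderiv_comp y (hdI _ (hmaps y hy)) (hda y hy)]
    rfl
  have haT : a ∈ Ψ.target := by simpa [hΨa] using Ψ.map_source haΨ
  have hΨsa : Ψ.symm a = a := by
    conv_lhs => rw [← hΨa]
    exact Ψ.left_inv haΨ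
  -- I is transversally nondegenerate: otherwise w, pulled back, would lie in ker dI and hence in
  -- ker dG.
  have hKw : fderiv ℝ K a w ≠ 0 := by
    rw [hKd a haT]
    intro h0
    have h1 := hker _ (hmaps a haT) (by rw [hΨsa, hGa]) _ h0
    rw [hGd a haT, hw] at h1
    exact one_ne_zero h1
  have hcont : ContinuousOn (fun y => fderiv ℝ K y w) Ψ.target :=
    (hKc.continuousOn_fderiv_of_isOpen Ψ.open_target (by simp)).clm_apply continuousOn_const
  have hnhds : {y | y ∈ Ψ.target ∧ fderiv ℝ K y w ≠ 0} ∈ 𝓝 a := by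
    filter_upwards [Ψ.open_target.mem_nhds haT,
      (hcont.continuousAt (Ψ.open_target.mem_nhds haT)).eventually_ne hKw] with y h1 h2 using ⟨h1, h2⟩
  obtain ⟨r, hr, hball⟩ := Metric.mem_nhds_iff.1 hnhds
  have hKdiff : DifferentiableOn ℝ K Ψ.target := hKc.differentiableOn (by simp)
  have hT : Metric.ball a r ⊆ Ψ.target := fun y hy => (hball hy).1
  have hproj : ∀ᶠ y in 𝓝 a, y - L (y - a) • w ∈ Metric.ball a r := by
    have hc : Continuous fun y => y - L (y - a) • w := by fun_prop
    apply hc.continuousAt.preimage_mem_nhds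
    simpa using Metric.ball_mem_nhds a hr
  -- Project y along w to the point k of the hyperplane L (· - a) = 0. K is constant on the
  -- hyperplane, and from k to y it changes by L (y - a) times a nonzero derivative in direction w.
  have hkey : ∀ᶠ y in 𝓝 a, (L (y - a) = 0 ↔ K y = K a) := by
    filter_upwards [Metric.ball_mem_nhds a hr, hproj] with y hy hk
    set k := y - L (y - a) • w with hkdef
    have hLk : L (k - a) = 0 := by
      have : k - a = (y - a) - L (y - a) • w := by rw [hkdef]; abel
      rw [this, map_sub, map_smul, hw]
      simp
    have hsegk := (convex_ball a r).segment_subset (Metric.mem_ball_self hr) hk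
    have hka : K k = K a := by
      obtain ⟨z, hz, hzeq⟩ := exists_segment_sub_eq_fderiv Ψ.open_target hKdiff (hsegk.trans hT)
      have hzT := hT (hsegk hz)
      have hLz : L (z - a) = 0 := by
        obtain ⟨t, -, rfl⟩ := (segment_eq_image' ℝ a k).subset hz
        simp only [add_sub_cancel_left, map_smul, hLk, smul_zero]
      rw [hKd z hzT, hker' _ (hmaps z hzT) (by rw [hGs z hzT, hLz]) _ (by rw [hGd z hzT, hLk])]
        at hzeq
      linarith
    have hsegy := (convex_ball a r).segment_subset hk hy
    obtain ⟨z, hz, hzeq⟩ := exists_segment_sub_eq_fderiv Ψ.open_target hKdiff (hsegy.trans hT)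
    have hyk : y - k = L (y - a) • w := by rw [hkdef]; abel
    rw [hyk, map_smul, hka, smul_eq_mul] at hzeq
    have hzw := (hball (hsegy hz)).2
    constructor
    · intro h0
      rw [h0, zero_mul] at hzeq
      linarith
    · intro h0
      rw [h0, sub_self, zero_eq_mul] at hzeq
      exact hzeq.resolve_right hzw
  have hc : ContinuousAt Ψ a := Ψ.continuousAt haΨ
  rw [ContinuousAt, hΨa] at hc
  filter_upwards [hc.eventually hkey, Ψ.open_source.mem_nhds haΨ] with x hx hxs
  rw [hΨG x hxs, hGa, zero_add, hx, hK]
  simp only [Function.comp, Ψ.left_inv hxs, hΨsa]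

end Analysis

/-! ### Smooth functions of two variables and quadratic test polynomials. -/

/-- Smooth functions on the plane. -/
structure PlaneFn where
  /-- The underlying function. -/
  toFun : ℝ × ℝ → ℝ
  smooth : Smooth toFun

namespace PlaneFn

/-- The partial derivative by the first variable. -/
def p (A : PlaneFn) : PlaneFn :=
  ⟨MongeAmpere.d₁ A.toFun, (A.smooth.fderiv_right (m := ∞) (by simp)).clm_apply contDiff_const⟩

/-- The partial derivative by the second variable. -/
def q (A : PlaneFn) : PlaneFn :=
  ⟨MongeAmpere.d₂ A.toFun, (A.smooth.fderiv_right (m := ∞) (by simp)).clm_apply contDiff_const⟩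

lemma differentiableAt (A : PlaneFn) (m : ℝ × ℝ) : DifferentiableAt ℝ A.toFun m :=
  A.smooth.contDiffAt.differentiableAt (by simp)

lemma fderiv_apply (A : PlaneFn) (m v : ℝ × ℝ) :
    fderiv ℝ A.toFun m v = v.1 * A.p.toFun m + v.2 * A.q.toFun m := by
  have : v = v.1 • ((1, 0) : ℝ × ℝ) + v.2 • ((0, 1) : ℝ × ℝ) := by ext <;> simp
  conv_lhs => rw [this, map_add, map_smul, map_smul]
  rfl

/-- Symmetry of second derivatives. As a rewrite rule it brings mixed partials to a normal form with
`q` taken before `p`, so that `ring` can identify them. -/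
lemma q_p (A : PlaneFn) : A.p.q = A.q.p := by
  have hd : Differentiable ℝ (fderiv ℝ A.toFun) :=
    (A.smooth.fderiv_right (m := ∞) (by simp)).differentiable (by simp)
  have hs : ∀ m, IsSymmSndFDerivAt ℝ A.toFun m := fun m =>
    A.smooth.contDiffAt.isSymmSndFDerivAt (by rw [minSmoothness_of_isRCLikeNormedField]; exact WithTop.coe_le_coe.2 le_top)
  have h : ∀ (m v w : ℝ × ℝ), fderiv ℝ (fun n => fderiv ℝ A.toFun n v) m w
      = fderiv ℝ (fderiv ℝ A.toFun) m w v := by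
    intro m v w
    rw [fderiv_clm_apply (hd m) (differentiableAt_const v)]
    simp
  have : A.p.q.toFun = A.q.p.toFun := by
    funext m
    change fderiv ℝ (fun n => fderiv ℝ A.toFun n (1, 0)) m (0, 1)
      = fderiv ℝ (fun n => fderiv ℝ A.toFun n (0, 1)) m (1, 0)
    rw [h, h]
    exact hs m _ _
  cases h1 : A.p.q
  cases h2 : A.q.p
  simp_all

/-- The quadratic polynomial with given second order jet at `m`. -/
def quad (m : ℝ × ℝ) (c a b aa ab bb : ℝ) : PlaneFn :=
  ⟨fun n => c + a * (n.1 - m.1) + b * (n.2 - m.2) + aa / 2 * (n.1 - m.1) ^ 2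
    + ab * ((n.1 - m.1) * (n.2 - m.2)) + bb / 2 * (n.2 - m.2) ^ 2, by
    unfold Smooth
    fun_prop⟩

lemma quad_apply (m : ℝ × ℝ) (c a b aa ab bb : ℝ) : (quad m c a b aa ab bb).toFun m = c := by
  simp [quad]

lemma fderiv_quad (m n v : ℝ × ℝ) (c a b aa ab bb : ℝ) :
    fderiv ℝ (quad m c a b aa ab bb).toFun n v =
      v.1 * (a + aa * (n.1 - m.1) + ab * (n.2 - m.2))
        + v.2 * (b + ab * (n.1 - m.1) + bb * (n.2 - m.2)) := by
  have h1 : HasFDerivAt (fun n : ℝ × ℝ => n.1 - m.1) (ContinuousLinearMap.fst ℝ ℝ ℝ) n :=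
    hasFDerivAt_fst.sub_const _
  have h2 : HasFDerivAt (fun n : ℝ × ℝ => n.2 - m.2) (ContinuousLinearMap.snd ℝ ℝ ℝ) n :=
    hasFDerivAt_snd.sub_const _
  have h := (((((hasFDerivAt_const c n).add (h1.const_mul a)).add (h2.const_mul b)).add
    ((h1.pow 2).const_mul (aa / 2))).add ((h1.mul h2).const_mul ab)).add
    ((h2.pow 2).const_mul (bb / 2))
  have h' : HasFDerivAt (quad m c a b aa ab bb).toFun _ n := h
  rw [h'.fderiv]
  simp
  ring

lemma quad_p (m : ℝ × ℝ) (c a b aa ab bb : ℝ) :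
    (quad m c a b aa ab bb).p = quad m a aa ab 0 0 0 := by
  have : (quad m c a b aa ab bb).p.toFun = (quad m a aa ab 0 0 0).toFun := by
    funext n
    refine (fderiv_quad m n (1, 0) c a b aa ab bb).trans ?_
    simp [quad]
  cases h1 : (quad m c a b aa ab bb).p
  cases h2 : quad m a aa ab 0 0 0
  simp_all

lemma quad_q (m : ℝ × ℝ) (c a b aa ab bb : ℝ) :
    (quad m c a b aa ab bb).q = quad m b ab bb 0 0 0 := by
  have : (quad m c a b aa ab bb).q.toFun = (quad m b ab bb 0 0 0).toFun := by
    funext n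
    refine (fderiv_quad m n (0, 1) c a b aa ab bb).trans ?_
    simp [quad]
  cases h1 : (quad m c a b aa ab bb).q
  cases h2 : quad m b ab bb 0 0 0
  simp_all

end PlaneFn

/-! ### A symbolic calculus for functions on J¹ that do not involve u. -/

/-- The indices of the coordinates `xⁱ` and `uᵢ` of `J¹`. -/
abbrev Idx : Type := Fin 4 ⊕ Fin 4

/-- The coordinates `xⁱ` and `uᵢ` of `J¹`. -/
def crd (k : Idx) (θ : J1) : ℝ := Sum.elim θ.1 θ.2.2 k

/-- Expressions in the coordinates `xⁱ`, `uᵢ` and smooth functions of pairs of coordinates. -/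
inductive Expr : Type
  | const (r : ℝ)
  | var (k : Idx)
  | fn (A : PlaneFn) (k l : Idx)
  | add (e e' : Expr)
  | mul (e e' : Expr)

namespace Expr

/-- The function on `J¹` given by an expression. -/
def eval (θ : J1) : Expr → ℝ
  | const r => r
  | var k => crd k θ
  | fn A k l => A.toFun (crd k θ, crd l θ)
  | add e e' => e.eval θ + e'.eval θ
  | mul e e' => e.eval θ * e'.eval θ

/-- The derivative of an expression in a constant direction. -/
def der (v : Idx → ℝ) : Expr → Expr
  | const _ => const 0
  | var k => const (v k)
  | fn A k l => add (mul (const (v k)) (fn A.p k l)) (mul (const (v l)) (fn A.q k l))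
  | add e e' => add (der v e) (der v e')
  | mul e e' => add (mul (der v e) e') (mul e (der v e'))

lemma contDiff_crd (k : Idx) : ContDiff ℝ ∞ (crd k) := by
  rcases k with i | i
  · change ContDiff ℝ ∞ (fun θ : J1 => θ.1 i)
    fun_prop
  · change ContDiff ℝ ∞ (fun θ : J1 => θ.2.2 i)
    fun_prop

lemma fderiv_crd (k : Idx) (θ v : J1) : fderiv ℝ (crd k) θ v = crd k v := by
  rcases k with i | i
  · let P : J1 →L[ℝ] ℝ := (ContinuousLinearMap.proj i).comp (ContinuousLinearMap.fst ℝ _ _)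
    exact congrArg (fun T : J1 →L[ℝ] ℝ => T v) (P.hasFDerivAt (x := θ)).fderiv
  · let P : J1 →L[ℝ] ℝ := (ContinuousLinearMap.proj i).comp
      ((ContinuousLinearMap.snd ℝ _ _).comp (ContinuousLinearMap.snd ℝ _ _))
    exact congrArg (fun T : J1 →L[ℝ] ℝ => T v) (P.hasFDerivAt (x := θ)).fderiv

lemma contDiff_eval (e : Expr) : ContDiff ℝ ∞ fun θ => e.eval θ := by
  induction e with
  | const r => exact contDiff_const
  | var k => exact contDiff_crd k
  | fn A k l => exact A.smooth.comp ((contDiff_crd k).prodMk (contDiff_crd l))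
  | add e e' h h' => exact h.add h'
  | mul e e' h h' => exact h.mul h'

lemma differentiableAt_eval (e : Expr) (θ : J1) : DifferentiableAt ℝ (fun θ => e.eval θ) θ :=
  e.contDiff_eval.contDiffAt.differentiableAt (by simp)

/-- The ∂ᵤ component of v drops out because no expression depends on u; the other coordinates are
linear, so v enters only through constants. -/
lemma fderiv_eval (e : Expr) (θ v : J1) :
    fderiv ℝ (fun θ => e.eval θ) θ v = (e.der fun k => crd k v).eval θ := by
  induction e with
  | const r => simp [eval, der]
  | var k => exact fderiv_crd k θ v
  | fn A k l =>
    have hk := ((contDiff_crd k).contDiffAt (x := θ)).differentiableAt (by simp)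
    have hl := ((contDiff_crd l).contDiffAt (x := θ)).differentiableAt (by simp)
    have h : (fun θ => (fn A k l).eval θ) = A.toFun ∘ fun θ => (crd k θ, crd l θ) := rfl
    rw [h, fderiv_comp θ (A.differentiableAt _) (hk.prodMk hl), hk.fderiv_prodMk hl]
    simp only [ContinuousLinearMap.comp_apply, ContinuousLinearMap.prod_apply, A.fderiv_apply,
      fderiv_crd, der, eval]
  | add e e' h h' =>
    have := fderiv_fun_add (e.differentiableAt_eval θ) (e'.differentiableAt_eval θ)
    change fderiv ℝ (fun θ => e.eval θ + e'.eval θ) θ v = _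
    rw [this]
    simp [h, h', der, eval]
  | mul e e' h h' =>
    have := fderiv_fun_mul (e.differentiableAt_eval θ) (e'.differentiableAt_eval θ)
    change fderiv ℝ (fun θ => e.eval θ * e'.eval θ) θ v = _
    rw [this]
    simp [h, h', der, eval]
    ring

/-- The coordinates of the part of `Dᵢ` that does not involve `∂ᵤ`. -/
def dirIdx (θ : J2) (i : Fin 4) : Idx → ℝ := Sum.elim (Pi.single i 1) fun k => hess θ i k

lemma totalD_eval (e : Expr) (i : Fin 4) (θ : J2) :
    totalD i (fun θ => e.eval θ) θ = (e.der (dirIdx θ i)).eval θ.1 := by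
  rw [totalD, fderiv_eval]
  congr 2

/-- The coefficients of Dⱼ seen by expressions are constants and uⱼₖ. The latter are frozen in the
truncated outer derivative, so symbolic differentiation can simply be iterated. -/
lemma totalD2_eval (e : Expr) (i j : Fin 4) (θ : J2) :
    totalD2 i j (fun θ => e.eval θ) θ = ((e.der (dirIdx θ j)).der (dirIdx θ i)).eval θ.1 := by
  rw [totalD2, ← totalD_eval]
  congr 1
  funext ϑ
  exact totalD_eval e j (ϑ, θ.2)

lemma dP_eval (e : Expr) (i : Fin 4) (θ : J1) :
    dP i (fun θ => e.eval θ) θ = (e.der (Sum.elim 0 (Pi.single i 1))).eval θ := by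
  rw [dP, fderiv_eval]
  congr 2

end Expr

/-! ### Prolonged fields and linear forms in coordinates. -/

lemma hess_prolong (f : J1 → ℝ) (θ : J2) {i j : Fin 4} (h : i ≤ j) :
    hess (prolong f θ) i j = totalD2 i j f θ := by
  simp [hess, prolong, h]

lemma hess_comm (θ : J2) (i j : Fin 4) : hess θ i j = hess θ j i := by
  rw [hess, hess, Sym2.eq_swap]

lemma prolong_x (f : J1 → ℝ) (θ : J2) (i : Fin 4) : (prolong f θ).1.1 i = - dP i f θ.1 := rfl

lemma prolong_u (f : J1 → ℝ) (θ : J2) :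
    (prolong f θ).1.2.1 = f θ.1 - ∑ i, θ.1.2.2 i * dP i f θ.1 := rfl

lemma prolong_p (e : Expr) (θ : J2) (i : Fin 4) :
    (prolong (fun θ => e.eval θ) θ).1.2.2 i
      = (e.der (Sum.elim (Pi.single i 1) 0)).eval θ.1 := by
  change fderiv ℝ _ θ.1 (Pi.single i 1, θ.1.2.2 i, 0) = _
  rw [Expr.fderiv_eval]
  congr 2

/-- A linear form on `J²` in coordinates. -/
lemma exists_coeff (l : J2 →L[ℝ] ℝ) :
    ∃ (a : Fin 4 → ℝ) (c : ℝ) (b : Fin 4 → ℝ) (n : Fin 4 → Fin 4 → ℝ), ∀ v : J2,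
      l v = a 0 * v.1.1 0 + a 1 * v.1.1 1 + a 2 * v.1.1 2 + a 3 * v.1.1 3 + c * v.1.2.1
        + b 0 * v.1.2.2 0 + b 1 * v.1.2.2 1 + b 2 * v.1.2.2 2 + b 3 * v.1.2.2 3
        + n 0 0 * hess v 0 0 + n 0 1 * hess v 0 1 + n 0 2 * hess v 0 2 + n 0 3 * hess v 0 3
        + n 1 1 * hess v 1 1 + n 1 2 * hess v 1 2 + n 1 3 * hess v 1 3
        + n 2 2 * hess v 2 2 + n 2 3 * hess v 2 3 + n 3 3 * hess v 3 3 := by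
  refine ⟨fun i => l ((Pi.single i 1, 0, 0), 0), l ((0, 1, 0), 0),
    fun i => l ((0, 0, Pi.single i 1), 0), fun i j => l (0, Pi.single s(i, j) 1), fun v => ?_⟩
  have h1 : ∀ w : Fin 4 → ℝ, w = ∑ i, w i • (Pi.single i 1 : Fin 4 → ℝ) := fun w =>
    (pi_eq_sum_univ' w)
  have h2 : ∀ w : Sym2 (Fin 4) → ℝ, w = ∑ i, w i • (Pi.single i 1 : Sym2 (Fin 4) → ℝ) := fun w =>
    (pi_eq_sum_univ' w)
  have huniv : (Finset.univ : Finset (Sym2 (Fin 4))) =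
      {s(0, 0), s(0, 1), s(0, 2), s(0, 3), s(1, 1), s(1, 2), s(1, 3), s(2, 2), s(2, 3), s(3, 3)} := by
    decide
  let ιx : (Fin 4 → ℝ) →L[ℝ] J2 := (ContinuousLinearMap.inl ℝ _ _).comp (ContinuousLinearMap.inl ℝ _ _)
  let ιp : (Fin 4 → ℝ) →L[ℝ] J2 := (ContinuousLinearMap.inl ℝ _ _).comp
    ((ContinuousLinearMap.inr ℝ _ _).comp (ContinuousLinearMap.inr ℝ _ _))
  let ιs : (Sym2 (Fin 4) → ℝ) →L[ℝ] J2 := ContinuousLinearMap.inr ℝ _ _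
  have hv : v = ιx v.1.1 + v.1.2.1 • (((0, 1, 0), 0) : J2) + ιp v.1.2.2 + ιs v.2 := by
    ext <;> simp [ιx, ιp, ιs]
  have hx : l (ιx v.1.1) = ∑ i, v.1.1 i * l (ιx (Pi.single i 1)) := by
    conv_lhs => rw [h1 v.1.1]
    simp
  have hp : l (ιp v.1.2.2) = ∑ i, v.1.2.2 i * l (ιp (Pi.single i 1)) := by
    conv_lhs => rw [h1 v.1.2.2]
    simp
  have hs : l (ιs v.2) = ∑ i, v.2 i * l (ιs (Pi.single i 1)) := by
    conv_lhs => rw [h2 v.2]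
    simp
  conv_lhs => rw [hv, map_add, map_add, map_add, map_smul, hx, hp, hs]
  rw [huniv]
  rw [Finset.sum_insert (by decide), Finset.sum_insert (by decide), Finset.sum_insert (by decide),
    Finset.sum_insert (by decide), Finset.sum_insert (by decide), Finset.sum_insert (by decide),
    Finset.sum_insert (by decide), Finset.sum_insert (by decide), Finset.sum_insert (by decide),
    Finset.sum_singleton, Fin.sum_univ_four, Fin.sum_univ_four]
  simp only [hess, ιx, ιp, ιs, ContinuousLinearMap.comp_apply, ContinuousLinearMap.inl_apply,
    ContinuousLinearMap.inr_apply, smul_eq_mul, ← Prod.mk_zero_zero]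
  ring

instance : Add Expr := ⟨Expr.add⟩
instance : Mul Expr := ⟨Expr.mul⟩

namespace Expr

lemma eval_add (e e' : Expr) (θ : J1) : (e + e').eval θ = e.eval θ + e'.eval θ := rfl
lemma eval_mul (e e' : Expr) (θ : J1) : (e * e').eval θ = e.eval θ * e'.eval θ := rfl
lemma eval_const (r : ℝ) (θ : J1) : (const r).eval θ = r := rfl
lemma eval_var (k : Idx) (θ : J1) : (var k).eval θ = crd k θ := rfl
lemma eval_fn (A : PlaneFn) (k l : Idx) (θ : J1) :
    (fn A k l).eval θ = A.toFun (crd k θ, crd l θ) := rfl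
lemma der_add (v : Idx → ℝ) (e e' : Expr) : (e + e').der v = e.der v + e'.der v := rfl
lemma der_mul (v : Idx → ℝ) (e e' : Expr) : (e * e').der v = e.der v * e' + e * e'.der v := rfl
lemma der_const (v : Idx → ℝ) (r : ℝ) : (const r).der v = const 0 := rfl
lemma der_var (v : Idx → ℝ) (k : Idx) : (var k).der v = const (v k) := rfl
lemma der_fn (v : Idx → ℝ) (A : PlaneFn) (k l : Idx) :
    (fn A k l).der v = const (v k) * fn A.p k l + const (v l) * fn A.q k l := rfl

/-- The coordinate `xⁱ`. -/
def X (i : Fin 4) : Expr := var (.inl i)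

/-- The coordinate `uᵢ`. -/
def P (i : Fin 4) : Expr := var (.inr i)

/-- The function `A(xⁱ, xʲ)`. -/
def fxx (A : PlaneFn) (i j : Fin 4) : Expr := fn A (.inl i) (.inl j)

/-- The function `A(xⁱ, uᵢ)`. -/
def fxp (A : PlaneFn) (i : Fin 4) : Expr := fn A (.inl i) (.inr i)

end Expr

/-! ### The generating functions as expressions. -/

open MongeAmpere.Expr in
/-- The generating functions of the infinite part of the symmetry algebra, as expressions. -/
def genExpr : MAType → PlaneFn → PlaneFn → PlaneFn → PlaneFn → Expr
  | .O, _, _, _, _ => const 0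
  | .N, A, B, C, D =>
    fxx A.p 3 2 * P 2 + const (-1) * fxx A.q 3 2 * P 3
      + (fxx A.p.p 3 2 * X 0 + fxx A.q.p 3 2 * X 1) * P 1
      + const (-1) * (fxx A.q.p 3 2 * X 0 + fxx A.q.q 3 2 * X 1) * P 0
      + const (-1 / 6) * (X 0 * X 0 * X 0 * fxx A.p.p.p 3 2
        + const 3 * X 0 * X 0 * X 1 * fxx A.q.p.p 3 2
        + const 3 * X 0 * X 1 * X 1 * fxx A.q.q.p 3 2 + X 1 * X 1 * X 1 * fxx A.q.q.q 3 2)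
      + fxx B.p 3 2 * P 1 + const (-1) * fxx B.q 3 2 * P 0
      + const (-1 / 2) * (X 0 * X 0 * fxx B.p.p 3 2
        + const 2 * X 0 * X 1 * fxx B.q.p 3 2 + X 1 * X 1 * fxx B.q.q 3 2)
      + X 0 * fxx C.p 3 2 + X 1 * fxx C.q 3 2 + fxx D 3 2
  | .D, A, B, C, D =>
    fxx A.p 0 1 * P 1 + const (-1) * fxx A.q 0 1 * P 0 + fxx B 0 1
      + fxx C.p 3 2 * P 2 + const (-1) * fxx C.q 3 2 * P 3 + fxx D 3 2
  | .III, A, B, C, D =>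
    fxx A.q 0 1 * P 0 + const (-1) * fxx A.p 0 1 * P 1
      + const (1 / 2) * (fxx A.q.q 0 1 * X 2 * X 2 + const (-2) * fxx A.q.p 0 1 * X 2 * P 2
        + fxx A.p.p 0 1 * P 2 * P 2)
      + fxx B.q 0 1 * X 2 + const (-1) * fxx B.p 0 1 * P 2 + fxx C 0 1 + fxp D 3
  | .II, A, B, C, D =>
    fxx A.q 1 2 * P 1 + const (-1) * fxx A.p 1 2 * P 2 + fxx B 1 2 + fxp C 0 + fxp D 3
  | .I, A, B, C, D => fxp A 0 + fxp B 1 + fxp C 2 + fxp D 3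

lemma nabla_toFun (x y : ℝ) (A : PlaneFn) :
    nabla x y A.toFun = fun m => x * A.p.toFun m + y * A.q.toFun m := rfl

lemma d₁_toFun (A : PlaneFn) : d₁ A.toFun = A.p.toFun := rfl

lemma d₂_toFun (A : PlaneFn) : d₂ A.toFun = A.q.toFun := rfl

lemma fderiv_comb (x y : ℝ) (A B : PlaneFn) (m v : ℝ × ℝ) :
    fderiv ℝ (fun m => x * A.toFun m + y * B.toFun m) m v =
      x * fderiv ℝ A.toFun m v + y * fderiv ℝ B.toFun m v := by
  have h : HasFDerivAt (fun m => x * A.toFun m + y * B.toFun m) _ m :=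
    ((A.differentiableAt m).hasFDerivAt.const_mul x).add
      ((B.differentiableAt m).hasFDerivAt.const_mul y)
  rw [h.fderiv]
  simp

lemma nabla_nabla (x y : ℝ) (A : PlaneFn) :
    nabla x y (nabla x y A.toFun) = fun m => x * (x * A.p.p.toFun m + y * A.q.p.toFun m)
      + y * (x * A.q.p.toFun m + y * A.q.q.toFun m) := by
  funext m
  rw [nabla_toFun]
  simp only [nabla, d₁, d₂, fderiv_comb]
  change x * (x * A.p.p.toFun m + y * A.q.p.toFun m)
    + y * (x * A.p.q.toFun m + y * A.q.q.toFun m) = _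
  rw [A.q_p]

lemma nabla_nabla_nabla (x y : ℝ) (A : PlaneFn) (m : ℝ × ℝ) :
    nabla x y (nabla x y (nabla x y A.toFun)) m =
      x ^ 3 * A.p.p.p.toFun m + 3 * x ^ 2 * y * A.q.p.p.toFun m
        + 3 * x * y ^ 2 * A.q.q.p.toFun m + y ^ 3 * A.q.q.q.toFun m := by
  -- With x and y held fixed, ∇A is again a plane function, so the formula for ∇² can be applied to
  -- it.
  have h : ∀ (A B : PlaneFn), ∃ C : PlaneFn, C.toFun = (fun m => x * A.toFun m + y * B.toFun m) ∧
      (∀ m, C.p.p.toFun m = x * A.p.p.toFun m + y * B.p.p.toFun m) ∧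
      (∀ m, C.q.p.toFun m = x * A.q.p.toFun m + y * B.q.p.toFun m) ∧
      (∀ m, C.q.q.toFun m = x * A.q.q.toFun m + y * B.q.q.toFun m) := by
    intro A B
    have hC : Smooth fun m => x * A.toFun m + y * B.toFun m :=
      (contDiff_const.mul A.smooth).add (contDiff_const.mul B.smooth)
    have hp : (PlaneFn.mk _ hC).p.toFun = fun m => x * A.p.toFun m + y * B.p.toFun m := by
      funext m
      exact fderiv_comb x y A B m (1, 0)
    have hq : (PlaneFn.mk _ hC).q.toFun = fun m => x * A.q.toFun m + y * B.q.toFun m := by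
      funext m
      exact fderiv_comb x y A B m (0, 1)
    refine ⟨⟨_, hC⟩, rfl, fun m => ?_, fun m => ?_, fun m => ?_⟩
    · change fderiv ℝ (PlaneFn.mk _ hC).p.toFun m (1, 0) = _
      rw [hp]
      exact fderiv_comb x y A.p B.p m (1, 0)
    · change fderiv ℝ (PlaneFn.mk _ hC).q.toFun m (1, 0) = _
      rw [hq]
      exact fderiv_comb x y A.q B.q m (1, 0)
    · change fderiv ℝ (PlaneFn.mk _ hC).q.toFun m (0, 1) = _
      rw [hq]
      exact fderiv_comb x y A.q B.q m (0, 1)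
  obtain ⟨C, hC, h1, h2, h3⟩ := h A.p A.q
  rw [nabla_toFun x y A, ← hC, nabla_nabla]
  simp only [h1, h2, h3, PlaneFn.q_p]
  ring

lemma eval_genExpr_N (A B C D : PlaneFn) :
    genN A.toFun B.toFun C.toFun D.toFun = fun θ => (genExpr .N A B C D).eval θ := by
  funext θ
  simp only [genN, nabla_nabla_nabla]
  simp only [nabla_nabla]
  simp only [nabla_toFun, d₁_toFun, d₂_toFun, genExpr,
    Expr.fxx, Expr.fxp, Expr.X, Expr.P,
    Expr.eval_add, Expr.eval_mul, Expr.eval_const, Expr.eval_var, Expr.eval_fn, crd, Sum.elim_inl,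
    Sum.elim_inr]
  ring

lemma eval_genExpr_D (A B C D : PlaneFn) :
    genD A.toFun B.toFun C.toFun D.toFun = fun θ => (genExpr .D A B C D).eval θ := by
  funext θ
  simp only [genD, d₁_toFun, d₂_toFun, genExpr,
    Expr.fxx, Expr.fxp, Expr.X, Expr.P,
    Expr.eval_add, Expr.eval_mul, Expr.eval_const, Expr.eval_var, Expr.eval_fn, crd, Sum.elim_inl,
    Sum.elim_inr]
  ring

lemma eval_genExpr_III (A B C D : PlaneFn) :
    genIII A.toFun B.toFun C.toFun D.toFun = fun θ => (genExpr .III A B C D).eval θ := by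
  funext θ
  simp only [genIII, d₁_toFun, d₂_toFun, genExpr,
    Expr.fxx, Expr.fxp, Expr.X, Expr.P,
    Expr.eval_add, Expr.eval_mul, Expr.eval_const, Expr.eval_var, Expr.eval_fn, crd, Sum.elim_inl,
    Sum.elim_inr]
  ring

lemma eval_genExpr_II (A B C D : PlaneFn) :
    genII A.toFun B.toFun C.toFun D.toFun = fun θ => (genExpr .II A B C D).eval θ := by
  funext θ
  simp only [genII, d₁_toFun, d₂_toFun, genExpr,
    Expr.fxx, Expr.fxp, Expr.X, Expr.P,
    Expr.eval_add, Expr.eval_mul, Expr.eval_const, Expr.eval_var, Expr.eval_fn, crd, Sum.elim_inl,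
    Sum.elim_inr]
  ring

lemma eval_genExpr_I (A B C D : PlaneFn) :
    genI A.toFun B.toFun C.toFun D.toFun = fun θ => (genExpr .I A B C D).eval θ := rfl

/-- Type O is excluded because its parameter is a wave on ℝ⁴, not a tuple of plane functions. -/
lemma mem_sInf_iff {τ : MAType} (hτ : τ ≠ .O) (f : J1 → ℝ) :
    f ∈ sInf τ ↔ ∃ A B C D : PlaneFn, f = fun θ => (genExpr τ A B C D).eval θ := by
  cases τ
  · exact absurd rfl hτ
  all_goals
    constructor
    · rintro ⟨A, B, C, D, hA, hB, hC, hD, rfl⟩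
      refine ⟨⟨A, hA⟩, ⟨B, hB⟩, ⟨C, hC⟩, ⟨D, hD⟩, ?_⟩
      first
        | exact eval_genExpr_N ⟨A, hA⟩ ⟨B, hB⟩ ⟨C, hC⟩ ⟨D, hD⟩
        | exact eval_genExpr_D ⟨A, hA⟩ ⟨B, hB⟩ ⟨C, hC⟩ ⟨D, hD⟩
        | exact eval_genExpr_III ⟨A, hA⟩ ⟨B, hB⟩ ⟨C, hC⟩ ⟨D, hD⟩
        | exact eval_genExpr_II ⟨A, hA⟩ ⟨B, hB⟩ ⟨C, hC⟩ ⟨D, hD⟩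
        | exact eval_genExpr_I ⟨A, hA⟩ ⟨B, hB⟩ ⟨C, hC⟩ ⟨D, hD⟩
    · rintro ⟨A, B, C, D, rfl⟩
      refine ⟨A.toFun, B.toFun, C.toFun, D.toFun, A.smooth, B.smooth, C.smooth, D.smooth, ?_⟩
      first
        | exact (eval_genExpr_N A B C D).symm
        | exact (eval_genExpr_D A B C D).symm
        | exact (eval_genExpr_III A B C D).symm
        | exact (eval_genExpr_II A B C D).symm
        | exact (eval_genExpr_I A B C D).symm

/-! ### The differential of the invariant and its behaviour under the symmetries. -/

/-- The second order coordinate `uᵢⱼ` as a continuous linear form. -/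
def hessL (i j : Fin 4) : J2 →L[ℝ] ℝ :=
  (ContinuousLinearMap.proj s(i, j)).comp (ContinuousLinearMap.snd ℝ _ _)

@[fun_prop]
lemma contDiff_hess (i j : Fin 4) : ContDiff ℝ ∞ fun θ => hess θ i j := (hessL i j).contDiff

@[fun_prop]
lemma differentiable_hess (i j : Fin 4) : Differentiable ℝ fun θ => hess θ i j :=
  (hessL i j).differentiable

lemma fderiv_hess (i j : Fin 4) (θ : J2) : fderiv ℝ (fun θ => hess θ i j) θ = hessL i j :=
  (hessL i j).fderiv

lemma hessL_apply (i j : Fin 4) (v : J2) : hessL i j v = hess v i j := rfl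

/-- The differential of the numerator of the invariant. -/
def numD : MAType → J2 → J2 → ℝ
  | .O, _, v => hess v 0 0 - hess v 1 1 - hess v 2 2 - hess v 3 3
  | .N, θ, v => hess v 1 3 - hess v 0 2 + hess θ 0 0 * hess v 1 1 + hess θ 1 1 * hess v 0 0
      - 2 * hess θ 0 1 * hess v 0 1
  | .D, θ, v => hess θ 0 3 * hess v 1 2 + hess θ 1 2 * hess v 0 3
      - hess θ 0 2 * hess v 1 3 - hess θ 1 3 * hess v 0 2
  | .III, θ, v => hess v 1 3 - hess θ 0 3 * hess v 2 2 - hess θ 2 2 * hess v 0 3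
      + hess θ 0 2 * hess v 2 3 + hess θ 2 3 * hess v 0 2
  | .II, θ, v => hess θ 0 2 * hess v 1 3 + hess θ 1 3 * hess v 0 2
      - hess θ 0 1 * hess v 2 3 - hess θ 2 3 * hess v 0 1
  | .I, θ, v => hess θ 0 1 * hess v 2 3 + hess θ 2 3 * hess v 0 1
      - hess θ 0 2 * hess v 1 3 - hess θ 1 3 * hess v 0 2

/-- The differential of the denominator of the invariant. -/
def denD : MAType → J2 → J2 → ℝ
  | .O, _, _ => 0
  | .N, _, _ => 0
  | .D, _, _ => 0
  | .III, _, v => hess v 2 3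
  | .II, _, v => hess v 0 3
  | .I, θ, v => hess θ 0 1 * hess v 2 3 + hess θ 2 3 * hess v 0 1
      - hess θ 0 3 * hess v 1 2 - hess θ 1 2 * hess v 0 3

lemma contDiff_invNum (τ : MAType) : ContDiff ℝ ∞ (invNum τ) := by
  cases τ <;> unfold invNum <;> fun_prop

lemma contDiff_invDen (τ : MAType) : ContDiff ℝ ∞ (invDen τ) := by
  cases τ <;> unfold invDen <;> fun_prop

lemma fderiv_invNum (τ : MAType) (θ v : J2) : fderiv ℝ (invNum τ) θ v = numD τ θ v := by
  cases τ <;> unfold invNum numD <;>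
    simp (disch := fun_prop) only [fderiv_fun_add, fderiv_fun_sub, fderiv_fun_mul, fderiv_fun_pow,
      fderiv_hess, add_apply, sub_apply,
      smul_apply, hessL_apply, smul_eq_mul, nsmul_eq_mul] <;>
    push_cast <;> ring

lemma fderiv_invDen (τ : MAType) (θ v : J2) : fderiv ℝ (invDen τ) θ v = denD τ θ v := by
  cases τ <;> unfold invDen denD <;>
    simp (disch := fun_prop) only [fderiv_fun_add, fderiv_fun_sub, fderiv_fun_mul, fderiv_fun_const,
      fderiv_hess, add_apply, sub_apply, Pi.zero_apply,
      zero_apply,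
      smul_apply, hessL_apply, smul_eq_mul] <;> ring

lemma isOpen_dom (τ : MAType) : IsOpen (dom τ) :=
  isOpen_ne_fun (contDiff_invDen τ).continuous continuous_const

lemma contDiffOn_inv (τ : MAType) : ContDiffOn ℝ ∞ (inv τ) (dom τ) :=
  (contDiff_invNum τ).contDiffOn.div (contDiff_invDen τ).contDiffOn fun _ h => h

lemma fderiv_inv {τ : MAType} {θ : J2} (hθ : θ ∈ dom τ) (v : J2) :
    fderiv ℝ (inv τ) θ v =
      (numD τ θ v * invDen τ θ - invNum τ θ * denD τ θ v) / invDen τ θ ^ 2 := by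
  have hne : invDen τ θ ≠ 0 := hθ
  have h1 := ((contDiffOn_inv τ θ hθ).contDiffAt ((isOpen_dom τ).mem_nhds hθ)).differentiableAt
    (by simp)
  have h2 := (contDiff_invDen τ).contDiffAt.differentiableAt (x := θ) (by simp)
  have h : (fun θ => inv τ θ * invDen τ θ) =ᶠ[𝓝 θ] invNum τ := by
    filter_upwards [(isOpen_dom τ).mem_nhds hθ] with θ' h'
    exact div_mul_cancel₀ _ h'
  have h3 := congrArg (fun T : J2 →L[ℝ] ℝ => T v) h.fderiv_eq
  simp only [fderiv_fun_mul h1 h2, add_apply, smul_apply, fderiv_invNum, fderiv_invDen,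
    smul_eq_mul] at h3
  rw [← h3, inv]
  field_simp
  ring

/-- Clearing the denominator makes all later conditions on dI polynomial in the uᵢⱼ. -/
lemma fderiv_inv_eq_zero_iff {τ : MAType} {θ : J2} (hθ : θ ∈ dom τ) (v : J2) :
    fderiv ℝ (inv τ) θ v = 0 ↔ numD τ θ v * invDen τ θ - invNum τ θ * denD τ θ v = 0 := by
  rw [fderiv_inv hθ, div_eq_zero_iff]
  have : invDen τ θ ≠ 0 := hθ
  simp [this]

/-- The factor by which a symmetry scales the numerator and the denominator of the invariant. -/
def scaleFactor (A B C D : PlaneFn) (θ : J2) : MAType → ℝ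
  | .O => 0
  | .N => 0
  | .D => 0
  | .III => -(fxx' A.q.p 0 1) + hess θ 2 2 * fxx' A.p.p 0 1 + fxp' D.q.p 3
      + hess θ 3 3 * fxp' D.q.q 3
  | .II => fxp' C.q.p 0 + hess θ 0 0 * fxp' C.q.q 0 + fxp' D.q.p 3 + hess θ 3 3 * fxp' D.q.q 3
  | .I => fxp' A.q.p 0 + hess θ 0 0 * fxp' A.q.q 0 + fxp' B.q.p 1 + hess θ 1 1 * fxp' B.q.q 1
      + fxp' C.q.p 2 + hess θ 2 2 * fxp' C.q.q 2 + fxp' D.q.p 3 + hess θ 3 3 * fxp' D.q.q 3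
where
  fxx' (A : PlaneFn) (i j : Fin 4) : ℝ := (Expr.fxx A i j).eval θ.1
  fxp' (A : PlaneFn) (i : Fin 4) : ℝ := (Expr.fxp A i).eval θ.1

lemma scale_N (A B C D : PlaneFn) (θ : J2) :
    numD .N θ (prolong (fun θ => (genExpr .N A B C D).eval θ) θ) = 0 := by
  simp only [numD, hess_prolong _ θ (show (0 : Fin 4) ≤ 0 by decide),
    hess_prolong _ θ (show (0 : Fin 4) ≤ 1 by decide),
    hess_prolong _ θ (show (0 : Fin 4) ≤ 2 by decide),
    hess_prolong _ θ (show (1 : Fin 4) ≤ 1 by decide),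
    hess_prolong _ θ (show (1 : Fin 4) ≤ 3 by decide), Expr.totalD2_eval, genExpr]
  simp [Expr.fxx, Expr.fxp, Expr.X, Expr.P, Expr.der_add, Expr.der_mul, Expr.der_const,
    Expr.der_var, Expr.der_fn, Expr.dirIdx,
    Expr.eval_add, Expr.eval_mul, Expr.eval_const, Expr.eval_var, Expr.eval_fn, PlaneFn.q_p, crd,
    hess_comm θ 1 0, hess_comm θ 2 0, hess_comm θ 3 0, hess_comm θ 2 1, hess_comm θ 3 1,
    hess_comm θ 3 2]
  ring

lemma scale_D (A B C D : PlaneFn) (θ : J2) :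
    numD .D θ (prolong (fun θ => (genExpr .D A B C D).eval θ) θ) = 0 := by
  simp only [numD, hess_prolong _ θ (show (0 : Fin 4) ≤ 3 by decide),
    hess_prolong _ θ (show (1 : Fin 4) ≤ 2 by decide),
    hess_prolong _ θ (show (0 : Fin 4) ≤ 2 by decide),
    hess_prolong _ θ (show (1 : Fin 4) ≤ 3 by decide), Expr.totalD2_eval, genExpr]
  simp [Expr.fxx, Expr.fxp, Expr.X, Expr.P, Expr.der_add, Expr.der_mul, Expr.der_const,
    Expr.der_var, Expr.der_fn, Expr.dirIdx,
    Expr.eval_add, Expr.eval_mul, Expr.eval_const, Expr.eval_var, Expr.eval_fn, PlaneFn.q_p, crd,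
    hess_comm θ 1 0, hess_comm θ 2 0, hess_comm θ 3 0, hess_comm θ 2 1, hess_comm θ 3 1,
    hess_comm θ 3 2]
  ring

lemma scale_III (A B C D : PlaneFn) (θ : J2) :
    numD .III θ (prolong (fun θ => (genExpr .III A B C D).eval θ) θ)
      = scaleFactor A B C D θ .III * invNum .III θ ∧
    denD .III θ (prolong (fun θ => (genExpr .III A B C D).eval θ) θ)
      = scaleFactor A B C D θ .III * invDen .III θ := by
  simp only [numD, denD, hess_prolong _ θ (show (0 : Fin 4) ≤ 3 by decide),
    hess_prolong _ θ (show (2 : Fin 4) ≤ 2 by decide),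
    hess_prolong _ θ (show (2 : Fin 4) ≤ 3 by decide),
    hess_prolong _ θ (show (0 : Fin 4) ≤ 2 by decide),
    hess_prolong _ θ (show (1 : Fin 4) ≤ 3 by decide), Expr.totalD2_eval, genExpr, scaleFactor,
    scaleFactor.fxx', scaleFactor.fxp', invNum, invDen]
  simp [Expr.fxx, Expr.fxp, Expr.X, Expr.P, Expr.der_add, Expr.der_mul, Expr.der_const,
    Expr.der_var, Expr.der_fn, Expr.dirIdx,
    Expr.eval_add, Expr.eval_mul, Expr.eval_const, Expr.eval_var, Expr.eval_fn, PlaneFn.q_p, crd,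
    hess_comm θ 1 0, hess_comm θ 2 0, hess_comm θ 3 0, hess_comm θ 2 1, hess_comm θ 3 1,
    hess_comm θ 3 2]
  constructor <;> ring

lemma scale_II (A B C D : PlaneFn) (θ : J2) :
    numD .II θ (prolong (fun θ => (genExpr .II A B C D).eval θ) θ)
      = scaleFactor A B C D θ .II * invNum .II θ ∧
    denD .II θ (prolong (fun θ => (genExpr .II A B C D).eval θ) θ)
      = scaleFactor A B C D θ .II * invDen .II θ := by
  simp only [numD, denD, hess_prolong _ θ (show (0 : Fin 4) ≤ 3 by decide),
    hess_prolong _ θ (show (0 : Fin 4) ≤ 1 by decide),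
    hess_prolong _ θ (show (2 : Fin 4) ≤ 3 by decide),
    hess_prolong _ θ (show (0 : Fin 4) ≤ 2 by decide),
    hess_prolong _ θ (show (1 : Fin 4) ≤ 3 by decide), Expr.totalD2_eval, genExpr, scaleFactor,
    scaleFactor.fxx', scaleFactor.fxp', invNum, invDen]
  simp [Expr.fxx, Expr.fxp, Expr.X, Expr.P, Expr.der_add, Expr.der_mul, Expr.der_const,
    Expr.der_var, Expr.der_fn, Expr.dirIdx,
    Expr.eval_add, Expr.eval_mul, Expr.eval_const, Expr.eval_var, Expr.eval_fn, PlaneFn.q_p, crd,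
    hess_comm θ 1 0, hess_comm θ 2 0, hess_comm θ 3 0, hess_comm θ 2 1, hess_comm θ 3 1,
    hess_comm θ 3 2]
  constructor <;> ring

/-- Each of the products u₁₂u₃₄, u₁₃u₂₄, u₁₄u₂₃ contains every index once. A parameter A(xⁱ, uᵢ)
changes all three by the same multiple of themselves plus the same cubic term, the second
uᵢ-derivative of A times the three uᵢⱼ with j ≠ i. The cubic term cancels in differences. -/
lemma scale_I (A B C D : PlaneFn) (θ : J2) :
    numD .I θ (prolong (fun θ => (genExpr .I A B C D).eval θ) θ)
      = scaleFactor A B C D θ .I * invNum .I θ ∧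
    denD .I θ (prolong (fun θ => (genExpr .I A B C D).eval θ) θ)
      = scaleFactor A B C D θ .I * invDen .I θ := by
  simp only [numD, denD, hess_prolong _ θ (show (0 : Fin 4) ≤ 3 by decide),
    hess_prolong _ θ (show (0 : Fin 4) ≤ 1 by decide),
    hess_prolong _ θ (show (2 : Fin 4) ≤ 3 by decide),
    hess_prolong _ θ (show (0 : Fin 4) ≤ 2 by decide),
    hess_prolong _ θ (show (1 : Fin 4) ≤ 2 by decide),
    hess_prolong _ θ (show (1 : Fin 4) ≤ 3 by decide), Expr.totalD2_eval, genExpr, scaleFactor,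
    scaleFactor.fxx', scaleFactor.fxp', invNum, invDen]
  simp [Expr.fxx, Expr.fxp, Expr.X, Expr.P, Expr.der_add, Expr.der_mul, Expr.der_const,
    Expr.der_var, Expr.der_fn, Expr.dirIdx,
    Expr.eval_add, Expr.eval_mul, Expr.eval_const, Expr.eval_var, Expr.eval_fn, PlaneFn.q_p, crd,
    hess_comm θ 1 0, hess_comm θ 2 0, hess_comm θ 3 0, hess_comm θ 2 1, hess_comm θ 3 1,
    hess_comm θ 3 2]
  constructor <;> ring

-- Test functions and the linear algebra of the relations they produce.

attribute [simp] PlaneFn.quad_apply PlaneFn.quad_p PlaneFn.quad_q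

@[simp]
lemma PlaneFn.quad_const_apply (m n : ℝ × ℝ) (c : ℝ) : (quad m c 0 0 0 0 0).toFun n = c := by
  simp [quad]

/-- The zero function. -/
def PlaneFn.nil : PlaneFn := quad 0 0 0 0 0 0 0

@[simp]
lemma PlaneFn.nil_p : nil.p = nil := quad_p _ _ _ _ _ _ _

@[simp]
lemma PlaneFn.nil_q : nil.q = nil := quad_q _ _ _ _ _ _ _

@[simp]
lemma PlaneFn.nil_apply (n : ℝ × ℝ) : nil.toFun n = 0 := quad_const_apply _ _ _

/-- The value of a linear form with given coefficients on a prolonged contact field. -/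
def coeffProlong (a : Fin 4 → ℝ) (c : ℝ) (b : Fin 4 → ℝ) (n : Fin 4 → Fin 4 → ℝ) (θ : J2)
    (e : Expr) : ℝ :=
  (∑ i, -(a i + c * θ.1.2.2 i) * (e.der (Sum.elim 0 (Pi.single i 1))).eval θ.1)
    + c * e.eval θ.1
    + (∑ i, b i * (e.der (Sum.elim (Pi.single i 1) 0)).eval θ.1)
    + (n 0 0 * ((e.der (Expr.dirIdx θ 0)).der (Expr.dirIdx θ 0)).eval θ.1
      + n 0 1 * ((e.der (Expr.dirIdx θ 1)).der (Expr.dirIdx θ 0)).eval θ.1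
      + n 0 2 * ((e.der (Expr.dirIdx θ 2)).der (Expr.dirIdx θ 0)).eval θ.1
      + n 0 3 * ((e.der (Expr.dirIdx θ 3)).der (Expr.dirIdx θ 0)).eval θ.1
      + n 1 1 * ((e.der (Expr.dirIdx θ 1)).der (Expr.dirIdx θ 1)).eval θ.1
      + n 1 2 * ((e.der (Expr.dirIdx θ 2)).der (Expr.dirIdx θ 1)).eval θ.1
      + n 1 3 * ((e.der (Expr.dirIdx θ 3)).der (Expr.dirIdx θ 1)).eval θ.1
      + n 2 2 * ((e.der (Expr.dirIdx θ 2)).der (Expr.dirIdx θ 2)).eval θ.1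
      + n 2 3 * ((e.der (Expr.dirIdx θ 3)).der (Expr.dirIdx θ 2)).eval θ.1
      + n 3 3 * ((e.der (Expr.dirIdx θ 3)).der (Expr.dirIdx θ 3)).eval θ.1)

lemma apply_prolong {l : J2 →L[ℝ] ℝ} {a : Fin 4 → ℝ} {c : ℝ} {b : Fin 4 → ℝ}
    {n : Fin 4 → Fin 4 → ℝ} (hl : ∀ v : J2,
      l v = a 0 * v.1.1 0 + a 1 * v.1.1 1 + a 2 * v.1.1 2 + a 3 * v.1.1 3 + c * v.1.2.1
        + b 0 * v.1.2.2 0 + b 1 * v.1.2.2 1 + b 2 * v.1.2.2 2 + b 3 * v.1.2.2 3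
        + n 0 0 * hess v 0 0 + n 0 1 * hess v 0 1 + n 0 2 * hess v 0 2 + n 0 3 * hess v 0 3
        + n 1 1 * hess v 1 1 + n 1 2 * hess v 1 2 + n 1 3 * hess v 1 3
        + n 2 2 * hess v 2 2 + n 2 3 * hess v 2 3 + n 3 3 * hess v 3 3) (θ : J2) (e : Expr) :
    l (prolong (fun θ => e.eval θ) θ) = coeffProlong a c b n θ e := by
  rw [hl, coeffProlong]
  simp only [prolong_x, prolong_u, prolong_p, Expr.dP_eval,
    hess_prolong _ θ (show (0 : Fin 4) ≤ 0 by decide),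
    hess_prolong _ θ (show (0 : Fin 4) ≤ 1 by decide),
    hess_prolong _ θ (show (0 : Fin 4) ≤ 2 by decide),
    hess_prolong _ θ (show (0 : Fin 4) ≤ 3 by decide),
    hess_prolong _ θ (show (1 : Fin 4) ≤ 1 by decide),
    hess_prolong _ θ (show (1 : Fin 4) ≤ 2 by decide),
    hess_prolong _ θ (show (1 : Fin 4) ≤ 3 by decide),
    hess_prolong _ θ (show (2 : Fin 4) ≤ 2 by decide),
    hess_prolong _ θ (show (2 : Fin 4) ≤ 3 by decide),
    hess_prolong _ θ (show (3 : Fin 4) ≤ 3 by decide), Expr.totalD2_eval, Fin.sum_univ_four]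
  ring

/-- For M with rows (p, q), (r, s) and N with rows (a, b), (c, d), the hypotheses say that N Mᵀ and
Nᵀ M are scalar. Then N is a multiple of the cofactor matrix, the differential of the determinant at
M. Using both products covers M of rank one; the multiple is read off at any nonzero entry of M. -/
lemma eq_smul_cofactor {p q r s a b c d : ℝ} (hM : p ≠ 0 ∨ q ≠ 0 ∨ r ≠ 0 ∨ s ≠ 0)
    (h1 : a * r + b * s = 0) (h2 : c * p + d * q = 0) (h3 : a * p + b * q = c * r + d * s)
    (h4 : b * p + d * r = 0) (h5 : a * q + c * s = 0) (h6 : a * p + c * r = b * q + d * s) :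
    ∃ μ, a = μ * s ∧ b = -μ * r ∧ c = -μ * q ∧ d = μ * p := by
  have h7 : b * q = c * r := by linarith
  have h8 : a * p = d * s := by linarith
  rcases hM with h | h | h | h
  · refine ⟨d / p, ?_, ?_, ?_, ?_⟩ <;> field_simp <;> linarith
  · refine ⟨-c / q, ?_, ?_, ?_, ?_⟩ <;> field_simp <;> linarith
  · refine ⟨-b / r, ?_, ?_, ?_, ?_⟩ <;> field_simp <;> linarith
  · refine ⟨a / s, ?_, ?_, ?_, ?_⟩ <;> field_simp <;> linarith

/-- Small letters stand for the uᵢⱼ, primes for complementary index pairs, and capitals for the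
coefficients of the unknown form. With a = pp', b = qq', c = rr', the differential of (a - b)/(a -
c) is proportional to (b - c) da - (a - c) db + (a - b) dc, the second factor on each side.
Proportionality is stated by cross multiplication: the fifteen identities `mPP`, …, `m12` are the
2×2 minors of the two coefficient vectors, so no case distinction on vanishing uᵢⱼ is needed. -/
lemma proportional_of_relations {P P' Q Q' R R' p p' q q' r r' : ℝ}
    (e0 : P * p + Q * q + R * r = 0) (e1 : P * p + R' * r' + Q' * q' = 0)
    (e2 : Q * q + R' * r' + P' * p' = 0) (e3 : R * r + Q' * q' + P' * p' = 0)
    (f0 : R' * (p * q) + Q' * (p * r) + P' * (q * r) = 0)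
    (f1 : Q * (p * r') + R * (p * q') + P' * (r' * q') = 0)
    (f2 : P * (q * r') + R * (q * p') + Q' * (r' * p') = 0)
    (f3 : P * (r * q') + Q * (r * p') + R' * (q' * p') = 0)
    (x x' y y' z z' X X' Y Y' Z Z' : ℝ) :
    (P * x + P' * x' + Q * y + Q' * y' + R * z + R' * z') *
        ((q * q' - r * r') * (p' * X + p * X') - (p * p' - r * r') * (q' * Y + q * Y')
          + (p * p' - q * q') * (r' * Z + r * Z')) =
      (P * X + P' * X' + Q * Y + Q' * Y' + R * Z + R' * Z') *
        ((q * q' - r * r') * (p' * x + p * x') - (p * p' - r * r') * (q' * y + q * y')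
          + (p * p' - q * q') * (r' * z + r * z')) := by
  -- The relations e₀, …, e₃ amount to equality of the products on complementary pairs and the
  -- vanishing of one sum.
  have hP : P' * p' = P * p := by linear_combination (e2 + e3 - e0 - e1) / 2
  have hQ : Q' * q' = Q * q := by linear_combination (e1 + e3 - e0 - e2) / 2
  have hR : R' * r' = R * r := by linear_combination (e1 + e2 - e0 - e3) / 2
  have s3 : P * p + Q * q + R' * r' = 0 := by linarith
  have s2 : P * p + R * r + Q' * q' = 0 := by linarith
  have s1 : Q * q + R * r + P' * p' = 0 := by linarith
  have s0 : R' * r' + Q' * q' + P' * p' = 0 := by linarith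
  have mPP : P * ((q * q' - r * r') * p) = P' * ((q * q' - r * r') * p') := by
    linear_combination -(q * q' - r * r') * hP
  have mQQ : Q * (-(p * p' - r * r') * q) = Q' * (-(p * p' - r * r') * q') := by
    linear_combination (p * p' - r * r') * hQ
  have mRR : R * ((p * p' - q * q') * r) = R' * ((p * p' - q * q') * r') := by
    linear_combination -(p * p' - q * q') * hR
  have m1 : P * (-(p * p' - r * r') * q') = Q * ((q * q' - r * r') * p') := by
    linear_combination f3 * r' - q' * p' * s3
  have m2 : P * ((p * p' - q * q') * r') = R * ((q * q' - r * r') * p') := by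
    linear_combination -(f2 * q' - r' * p' * s2)
  have m3 : P * ((p * p' - q * q') * r) = R' * ((q * q' - r * r') * p') := by
    linear_combination -(f3 * q - r * p' * s3)
  have m4 : P * (-(p * p' - r * r') * q) = Q' * ((q * q' - r * r') * p') := by
    linear_combination f2 * r - q * p' * s2
  have m5 : P' * (-(p * p' - r * r') * q') = Q * ((q * q' - r * r') * p) := by
    linear_combination f1 * r - q' * p * s1
  have m6 : P' * (-(p * p' - r * r') * q) = Q' * ((q * q' - r * r') * p) := by
    linear_combination f0 * r' - q * p * s0
  have m7 : P' * ((p * p' - q * q') * r') = R * ((q * q' - r * r') * p) := by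
    linear_combination -(f1 * q - r' * p * s1)
  have m8 : P' * ((p * p' - q * q') * r) = R' * ((q * q' - r * r') * p) := by
    linear_combination -(f0 * q' - r * p * s0)
  have m9 : Q * ((p * p' - q * q') * r') = R * (-(p * p' - r * r') * q') := by
    linear_combination f1 * p' - r' * q' * s1
  have m10 : Q * ((p * p' - q * q') * r) = R' * (-(p * p' - r * r') * q') := by
    linear_combination f3 * p - r * q' * s3
  have m11 : Q' * ((p * p' - q * q') * r') = R * (-(p * p' - r * r') * q) := by
    linear_combination f2 * p - r' * q * s2
  have m12 : Q' * ((p * p' - q * q') * r) = R' * (-(p * p' - r * r') * q) := by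
    linear_combination f0 * p' - r * q * s0
  linear_combination (x * X' - X * x') * mPP + (y * Y' - Y * y') * mQQ + (z * Z' - Z * z') * mRR
    + (x * Y - X * y) * m1 + (x * Z - X * z) * m2 + (x * Z' - X * z') * m3
    + (x * Y' - X * y') * m4 + (x' * Y - X' * y) * m5 + (x' * Y' - X' * y') * m6
    + (x' * Z - X' * z) * m7 + (x' * Z' - X' * z') * m8 + (y * Z - Y * z) * m9
    + (y * Z' - Y * z') * m10 + (y' * Z - Y' * z) * m11 + (y' * Z' - Y' * z') * m12

/-! For each type, a linear form that vanishes on all prolonged fields at a regular point vanishes on the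
kernel of the differential of the invariant: it is tested on generating functions with quadratic
parameters. -/

set_option maxHeartbeats 1000000 in
open PlaneFn in
-- The relations leave one free coefficient, `n 1 3`, and l is this multiple of dI. No regularity is
-- needed because dI has coefficient 1 at u₂₄.
lemma eq_zero_of_prolong_N (l : J2 →L[ℝ] ℝ) (θ : J2) (hl : ∀ A B C D : PlaneFn,
      l (prolong (fun θ => (genExpr .N A B C D).eval θ) θ) = 0)
    {v : J2} (hv : numD .N θ v = 0) : l v = 0 := by
  obtain ⟨a, c, b, n, hn⟩ := exists_coeff l
  simp only [apply_prolong hn] at hl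
  simp [coeffProlong, genExpr, Expr.fxx, Expr.fxp, Expr.X, Expr.P, Expr.der_add, Expr.der_mul,
    Expr.der_const, Expr.der_var, Expr.der_fn, Expr.dirIdx, Expr.eval_add, Expr.eval_mul,
    Expr.eval_const, Expr.eval_var, Expr.eval_fn, q_p, crd,
    hess_comm θ 1 0, hess_comm θ 2 0, hess_comm θ 3 0, hess_comm θ 2 1, hess_comm θ 3 1,
    hess_comm θ 3 2, Fin.sum_univ_four] at hl
  -- Each test prescribes a single Taylor coefficient of one parameter. A coefficient of l found to
  -- vanish is removed from `hl`, so that the next test isolates another one.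
  have hc : c = 0 := by simpa using hl nil nil nil (quad (θ.1.1 3, θ.1.1 2) 1 0 0 0 0 0)
  simp only [hc, zero_mul, mul_zero, add_zero, zero_add, neg_zero] at hl
  have hb3 : b 3 = 0 := by simpa using hl nil nil nil (quad (θ.1.1 3, θ.1.1 2) 0 1 0 0 0 0)
  simp only [hb3, zero_mul, mul_zero, add_zero, zero_add, neg_zero] at hl
  have hb2 : b 2 = 0 := by simpa using hl nil nil nil (quad (θ.1.1 3, θ.1.1 2) 0 0 1 0 0 0)
  simp only [hb2, zero_mul, mul_zero, add_zero, zero_add, neg_zero] at hl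
  have n33 : n 3 3 = 0 := by simpa using hl nil nil nil (quad (θ.1.1 3, θ.1.1 2) 0 0 0 1 0 0)
  simp only [n33, zero_mul, mul_zero, add_zero, zero_add, neg_zero] at hl
  have n23 : n 2 3 = 0 := by simpa using hl nil nil nil (quad (θ.1.1 3, θ.1.1 2) 0 0 0 0 1 0)
  simp only [n23, zero_mul, mul_zero, add_zero, zero_add, neg_zero] at hl
  have n22 : n 2 2 = 0 := by simpa using hl nil nil nil (quad (θ.1.1 3, θ.1.1 2) 0 0 0 0 0 1)
  simp only [n22, zero_mul, mul_zero, add_zero, zero_add, neg_zero] at hl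
  have hb0 : b 0 = 0 := by simpa using hl nil nil (quad (θ.1.1 3, θ.1.1 2) 0 1 0 0 0 0) nil
  simp only [hb0, zero_mul, mul_zero, add_zero, zero_add, neg_zero] at hl
  have hb1 : b 1 = 0 := by simpa using hl nil nil (quad (θ.1.1 3, θ.1.1 2) 0 0 1 0 0 0) nil
  simp only [hb1, zero_mul, mul_zero, add_zero, zero_add, neg_zero] at hl
  have n03 : n 0 3 = 0 := by simpa using hl nil nil (quad (θ.1.1 3, θ.1.1 2) 0 0 0 1 0 0) nil
  simp only [n03, zero_mul, mul_zero, add_zero, zero_add, neg_zero] at hl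
  have n12 : n 1 2 = 0 := by simpa using hl nil nil (quad (θ.1.1 3, θ.1.1 2) 0 0 0 0 0 1) nil
  simp only [n12, zero_mul, mul_zero, add_zero, zero_add, neg_zero] at hl
  have r1 : n 0 2 + n 1 3 = 0 := by
    have h := hl nil nil (quad (θ.1.1 3, θ.1.1 2) 0 0 0 0 1 0) nil
    simp only [quad_p, quad_q, quad_apply, nil_p, nil_q, nil_apply] at h
    linarith
  have ha1 : a 1 = 0 := by simpa using hl nil (quad (θ.1.1 3, θ.1.1 2) 0 1 0 0 0 0) nil nil
  simp only [ha1, zero_mul, mul_zero, add_zero, zero_add, neg_zero] at hl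
  have ha0 : a 0 = 0 := by simpa using hl nil (quad (θ.1.1 3, θ.1.1 2) 0 0 1 0 0 0) nil nil
  simp only [ha0, zero_mul, mul_zero, add_zero, zero_add, neg_zero] at hl
  have ha2 : a 2 = 0 := by simpa using hl (quad (θ.1.1 3, θ.1.1 2) 0 1 0 0 0 0) nil nil nil
  simp only [ha2, zero_mul, mul_zero, add_zero, zero_add, neg_zero] at hl
  have ha3 : a 3 = 0 := by simpa using hl (quad (θ.1.1 3, θ.1.1 2) 0 0 1 0 0 0) nil nil nil
  simp only [ha3, zero_mul, mul_zero, add_zero, zero_add, neg_zero] at hl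
  have r2 : n 0 0 - n 1 3 * hess θ 1 1 = 0 := by
    have h := hl nil (quad (θ.1.1 3, θ.1.1 2) 0 0 0 1 0 0) nil nil
    simp only [quad_p, quad_q, quad_apply, nil_p, nil_q, nil_apply] at h
    linarith
  have r3 : n 1 1 + n 0 2 * hess θ 0 0 = 0 := by
    have h := hl nil (quad (θ.1.1 3, θ.1.1 2) 0 0 0 0 0 1) nil nil
    simp only [quad_p, quad_q, quad_apply, nil_p, nil_q, nil_apply] at h
    linarith
  have r4 : n 0 1 - n 0 2 * hess θ 0 1 + n 1 3 * hess θ 0 1 = 0 := by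
    have h := hl nil (quad (θ.1.1 3, θ.1.1 2) 0 0 0 0 1 0) nil nil
    simp only [quad_p, quad_q, quad_apply, nil_p, nil_q, nil_apply] at h
    linarith
  rw [hn, hc, hb0, hb1, hb2, hb3, ha0, ha1, ha2, ha3, n03, n12, n22, n23, n33]
  have hv' := hv
  simp only [numD] at hv'
  linear_combination n 1 3 * hv' + (hess v 0 2 - hess θ 0 0 * hess v 1 1 + hess θ 0 1 * hess v 0 1) * r1
    + hess v 0 0 * r2 + hess v 1 1 * r3 + hess v 0 1 * r4

open PlaneFn in
lemma eq_zero_of_prolong_D (l : J2 →L[ℝ] ℝ) (θ : J2) (hl : ∀ A B C D : PlaneFn,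
      l (prolong (fun θ => (genExpr .D A B C D).eval θ) θ) = 0)
    (hreg : ∃ v, numD .D θ v ≠ 0)
    {v : J2} (hv : numD .D θ v = 0) : l v = 0 := by
  obtain ⟨a, c, b, n, hn⟩ := exists_coeff l
  simp only [apply_prolong hn] at hl
  simp [coeffProlong, genExpr, Expr.fxx, Expr.fxp, Expr.X, Expr.P, Expr.der_add, Expr.der_mul,
    Expr.der_const, Expr.der_var, Expr.der_fn, Expr.dirIdx, Expr.eval_add, Expr.eval_mul,
    Expr.eval_const, Expr.eval_var, Expr.eval_fn, q_p, crd,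
    hess_comm θ 1 0, hess_comm θ 2 0, hess_comm θ 3 0, hess_comm θ 2 1, hess_comm θ 3 1,
    hess_comm θ 3 2, Fin.sum_univ_four] at hl
  have hc : c = 0 := by simpa using hl nil (quad (θ.1.1 0, θ.1.1 1) 1 0 0 0 0 0) nil nil
  simp only [hc, zero_mul, mul_zero, add_zero, zero_add, neg_zero] at hl
  have hb0 : b 0 = 0 := by simpa using hl nil (quad (θ.1.1 0, θ.1.1 1) 0 1 0 0 0 0) nil nil
  simp only [hb0, zero_mul, mul_zero, add_zero, zero_add, neg_zero] at hl
  have hb1 : b 1 = 0 := by simpa using hl nil (quad (θ.1.1 0, θ.1.1 1) 0 0 1 0 0 0) nil nil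
  simp only [hb1, zero_mul, mul_zero, add_zero, zero_add, neg_zero] at hl
  have hb2 : b 2 = 0 := by simpa using hl nil nil nil (quad (θ.1.1 3, θ.1.1 2) 0 0 1 0 0 0)
  simp only [hb2, zero_mul, mul_zero, add_zero, zero_add, neg_zero] at hl
  have hb3 : b 3 = 0 := by simpa using hl nil nil nil (quad (θ.1.1 3, θ.1.1 2) 0 1 0 0 0 0)
  simp only [hb3, zero_mul, mul_zero, add_zero, zero_add, neg_zero] at hl
  have n00 : n 0 0 = 0 := by simpa using hl nil (quad (θ.1.1 0, θ.1.1 1) 0 0 0 1 0 0) nil nil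
  simp only [n00, zero_mul, mul_zero, add_zero, zero_add, neg_zero] at hl
  have n01 : n 0 1 = 0 := by simpa using hl nil (quad (θ.1.1 0, θ.1.1 1) 0 0 0 0 1 0) nil nil
  simp only [n01, zero_mul, mul_zero, add_zero, zero_add, neg_zero] at hl
  have n11 : n 1 1 = 0 := by simpa using hl nil (quad (θ.1.1 0, θ.1.1 1) 0 0 0 0 0 1) nil nil
  simp only [n11, zero_mul, mul_zero, add_zero, zero_add, neg_zero] at hl
  have n33 : n 3 3 = 0 := by simpa using hl nil nil nil (quad (θ.1.1 3, θ.1.1 2) 0 0 0 1 0 0)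
  simp only [n33, zero_mul, mul_zero, add_zero, zero_add, neg_zero] at hl
  have n23 : n 2 3 = 0 := by simpa using hl nil nil nil (quad (θ.1.1 3, θ.1.1 2) 0 0 0 0 1 0)
  simp only [n23, zero_mul, mul_zero, add_zero, zero_add, neg_zero] at hl
  have n22 : n 2 2 = 0 := by simpa using hl nil nil nil (quad (θ.1.1 3, θ.1.1 2) 0 0 0 0 0 1)
  simp only [n22, zero_mul, mul_zero, add_zero, zero_add, neg_zero] at hl
  have ha1 : a 1 = 0 := by simpa using hl (quad (θ.1.1 0, θ.1.1 1) 0 1 0 0 0 0) nil nil nil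
  simp only [ha1, zero_mul, mul_zero, add_zero, zero_add, neg_zero] at hl
  have ha0 : a 0 = 0 := by simpa using hl (quad (θ.1.1 0, θ.1.1 1) 0 0 1 0 0 0) nil nil nil
  simp only [ha0, zero_mul, mul_zero, add_zero, zero_add, neg_zero] at hl
  have ha2 : a 2 = 0 := by simpa using hl nil nil (quad (θ.1.1 3, θ.1.1 2) 0 1 0 0 0 0) nil
  simp only [ha2, zero_mul, mul_zero, add_zero, zero_add, neg_zero] at hl
  have ha3 : a 3 = 0 := by simpa using hl nil nil (quad (θ.1.1 3, θ.1.1 2) 0 0 1 0 0 0) nil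
  simp only [ha3, zero_mul, mul_zero, add_zero, zero_add, neg_zero] at hl
  have r1 : n 0 2 * hess θ 1 2 + n 0 3 * hess θ 1 3 = 0 := by
    have h := hl (quad (θ.1.1 0, θ.1.1 1) 0 0 0 1 0 0) nil nil nil
    simp only [quad_p, quad_q, quad_apply, nil_p, nil_q, nil_apply] at h
    linarith
  have r2 : n 1 2 * hess θ 0 2 + n 1 3 * hess θ 0 3 = 0 := by
    have h := hl (quad (θ.1.1 0, θ.1.1 1) 0 0 0 0 0 1) nil nil nil
    simp only [quad_p, quad_q, quad_apply, nil_p, nil_q, nil_apply] at h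
    linarith
  have r3 : n 1 2 * hess θ 1 2 + n 1 3 * hess θ 1 3 - n 0 2 * hess θ 0 2 - n 0 3 * hess θ 0 3 = 0 := by
    have h := hl (quad (θ.1.1 0, θ.1.1 1) 0 0 0 0 1 0) nil nil nil
    simp only [quad_p, quad_q, quad_apply, nil_p, nil_q, nil_apply] at h
    linarith
  have r4 : n 0 3 * hess θ 0 2 + n 1 3 * hess θ 1 2 = 0 := by
    have h := hl nil nil (quad (θ.1.1 3, θ.1.1 2) 0 0 0 1 0 0) nil
    simp only [quad_p, quad_q, quad_apply, nil_p, nil_q, nil_apply] at h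
    linarith
  have r5 : n 0 2 * hess θ 0 3 + n 1 2 * hess θ 1 3 = 0 := by
    have h := hl nil nil (quad (θ.1.1 3, θ.1.1 2) 0 0 0 0 0 1) nil
    simp only [quad_p, quad_q, quad_apply, nil_p, nil_q, nil_apply] at h
    linarith
  have r6 : n 0 2 * hess θ 0 2 + n 1 2 * hess θ 1 2 - n 0 3 * hess θ 0 3 - n 1 3 * hess θ 1 3 = 0 := by
    have h := hl nil nil (quad (θ.1.1 3, θ.1.1 2) 0 0 0 0 1 0) nil
    simp only [quad_p, quad_q, quad_apply, nil_p, nil_q, nil_apply] at h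
    linarith
  -- Up to sign I is the determinant of these four entries, so regularity says that the matrix is
  -- nonzero.
  have hM : hess θ 0 2 ≠ 0 ∨ hess θ 0 3 ≠ 0 ∨ hess θ 1 2 ≠ 0 ∨ hess θ 1 3 ≠ 0 := by
    by_contra! hcon
    obtain ⟨w, hw⟩ := hreg
    exact hw (by simp [numD, hcon])
  obtain ⟨μ, h1, h2, h3, h4⟩ := eq_smul_cofactor hM r1 r2 (by linarith) r4 r5 (by linarith)
  rw [hn, hc, hb0, hb1, hb2, hb3, ha0, ha1, ha2, ha3, n00, n01, n11, n22, n23, n33, h1, h2, h3, h4]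
  simp only [numD] at hv
  linear_combination (-μ) * hv

open PlaneFn in
lemma eq_zero_of_prolong_III (l : J2 →L[ℝ] ℝ) (θ : J2) (hl : ∀ A B C D : PlaneFn,
      l (prolong (fun θ => (genExpr .III A B C D).eval θ) θ) = 0)
    (hden : invDen .III θ ≠ 0)
    {v : J2} (hv : numD .III θ v * invDen .III θ - invNum .III θ * denD .III θ v = 0) : l v = 0 := by
  obtain ⟨a, c, b, n, hn⟩ := exists_coeff l
  simp only [apply_prolong hn] at hl
  simp [coeffProlong, genExpr, Expr.fxx, Expr.fxp, Expr.X, Expr.P, Expr.der_add, Expr.der_mul,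
    Expr.der_const, Expr.der_var, Expr.der_fn, Expr.dirIdx, Expr.eval_add, Expr.eval_mul,
    Expr.eval_const, Expr.eval_var, Expr.eval_fn, q_p, crd,
    hess_comm θ 1 0, hess_comm θ 2 0, hess_comm θ 3 0, hess_comm θ 2 1, hess_comm θ 3 1,
    hess_comm θ 3 2, Fin.sum_univ_four] at hl
  have hc : c = 0 := by simpa using hl nil nil (quad (θ.1.1 0, θ.1.1 1) 1 0 0 0 0 0) nil
  simp only [hc, zero_mul, mul_zero, add_zero, zero_add, neg_zero] at hl
  have hb0 : b 0 = 0 := by simpa using hl nil nil (quad (θ.1.1 0, θ.1.1 1) 0 1 0 0 0 0) nil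
  simp only [hb0, zero_mul, mul_zero, add_zero, zero_add, neg_zero] at hl
  have hb1 : b 1 = 0 := by simpa using hl nil nil (quad (θ.1.1 0, θ.1.1 1) 0 0 1 0 0 0) nil
  simp only [hb1, zero_mul, mul_zero, add_zero, zero_add, neg_zero] at hl
  have n00 : n 0 0 = 0 := by simpa using hl nil nil (quad (θ.1.1 0, θ.1.1 1) 0 0 0 1 0 0) nil
  simp only [n00, zero_mul, mul_zero, add_zero, zero_add, neg_zero] at hl
  have n01 : n 0 1 = 0 := by simpa using hl nil nil (quad (θ.1.1 0, θ.1.1 1) 0 0 0 0 1 0) nil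
  simp only [n01, zero_mul, mul_zero, add_zero, zero_add, neg_zero] at hl
  have n11 : n 1 1 = 0 := by simpa using hl nil nil (quad (θ.1.1 0, θ.1.1 1) 0 0 0 0 0 1) nil
  simp only [n11, zero_mul, mul_zero, add_zero, zero_add, neg_zero] at hl
  have hb3 : b 3 = 0 := by simpa using hl nil nil nil (quad (θ.1.1 3, θ.1.2.2 3) 0 1 0 0 0 0)
  simp only [hb3, zero_mul, mul_zero, add_zero, zero_add, neg_zero] at hl
  have ha3 : a 3 = 0 := by simpa using hl nil nil nil (quad (θ.1.1 3, θ.1.2.2 3) 0 0 1 0 0 0)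
  simp only [ha3, zero_mul, mul_zero, add_zero, zero_add, neg_zero] at hl
  have n33 : n 3 3 = 0 := by simpa using hl nil nil nil (quad (θ.1.1 3, θ.1.2.2 3) 0 0 0 1 0 0)
  simp only [n33, zero_mul, mul_zero, add_zero, zero_add, neg_zero] at hl
  have hb2 : b 2 = 0 := by simpa using hl nil (quad (θ.1.1 0, θ.1.1 1) 0 0 1 0 0 0) nil nil
  simp only [hb2, zero_mul, mul_zero, add_zero, zero_add, neg_zero] at hl
  have ha2 : a 2 = 0 := by simpa using hl nil (quad (θ.1.1 0, θ.1.1 1) 0 1 0 0 0 0) nil nil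
  simp only [ha2, zero_mul, mul_zero, add_zero, zero_add, neg_zero] at hl
  have n12 : n 1 2 = 0 := by simpa using hl nil (quad (θ.1.1 0, θ.1.1 1) 0 0 0 0 0 1) nil nil
  simp only [n12, zero_mul, mul_zero, add_zero, zero_add, neg_zero] at hl
  have ha1 : a 1 = 0 := by simpa using hl (quad (θ.1.1 0, θ.1.1 1) 0 1 0 0 0 0) nil nil nil
  simp only [ha1, zero_mul, mul_zero, add_zero, zero_add, neg_zero] at hl
  have ha0 : a 0 = 0 := by simpa using hl (quad (θ.1.1 0, θ.1.1 1) 0 0 1 0 0 0) nil nil nil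
  simp only [ha0, zero_mul, mul_zero, add_zero, zero_add, neg_zero] at hl
  have r1 : n 0 2 - n 1 3 * hess θ 2 3 = 0 := by
    have h := hl nil (quad (θ.1.1 0, θ.1.1 1) 0 0 0 0 1 0) nil nil
    simp only [quad_p, quad_q, quad_apply, nil_p, nil_q, nil_apply] at h
    linarith
  have r2 : n 0 2 * hess θ 2 2 + n 0 3 * hess θ 2 3 = 0 := by
    have h := hl nil (quad (θ.1.1 0, θ.1.1 1) 0 0 0 1 0 0) nil nil
    simp only [quad_p, quad_q, quad_apply, nil_p, nil_q, nil_apply] at h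
    linarith
  have t : n 0 3 * hess θ 0 3 + n 1 3 * hess θ 1 3 + n 2 3 * hess θ 2 3 = 0 := by
    have h := hl nil nil nil (quad (θ.1.1 3, θ.1.2.2 3) 0 0 0 0 1 0)
    simp only [quad_p, quad_q, quad_apply, nil_p, nil_q, nil_apply] at h
    linarith
  have r3 : hess θ 2 3 * (n 0 2 * hess θ 0 3 + n 2 2 * hess θ 2 3) = 0 := by
    have h := hl nil nil nil (quad (θ.1.1 3, θ.1.2.2 3) 0 0 0 0 0 1)
    simp only [quad_p, quad_q, quad_apply, nil_p, nil_q, nil_apply] at h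
    -- In the test with a second derivative by u₄, the terms containing u₄₄ are u₄₄ times the
    -- relation `t`.
    linear_combination h - hess θ 3 3 * t
  have hd : hess θ 2 3 ≠ 0 := hden
  have r3' := (mul_eq_zero.1 r3).resolve_left hd
  rw [hn, hc, hb0, hb1, hb2, hb3, ha0, ha1, ha2, ha3, n00, n01, n11, n12, n33]
  simp only [numD, denD, invNum, invDen] at hv
  refine (mul_eq_zero.1 (?_ : hess θ 2 3 ^ 2 * _ = 0)).resolve_left (pow_ne_zero 2 hd)
  linear_combination hess θ 2 3 * n 1 3 * hv + hess θ 2 3 ^ 2 * hess v 0 2 * r1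
    + hess θ 2 3 * hess v 0 3 * (r2 - hess θ 2 2 * r1)
    + hess θ 2 3 * hess v 2 2 * (r3' - hess θ 0 3 * r1)
    + hess v 2 3 * (hess θ 2 3 * t - hess θ 0 3 * (r2 - hess θ 2 2 * r1))

open PlaneFn in
lemma eq_zero_of_prolong_II (l : J2 →L[ℝ] ℝ) (θ : J2) (hl : ∀ A B C D : PlaneFn,
      l (prolong (fun θ => (genExpr .II A B C D).eval θ) θ) = 0)
    (hden : invDen .II θ ≠ 0)
    (hreg : ∃ v, numD .II θ v * invDen .II θ - invNum .II θ * denD .II θ v ≠ 0)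
    {v : J2} (hv : numD .II θ v * invDen .II θ - invNum .II θ * denD .II θ v = 0) : l v = 0 := by
  obtain ⟨a, c, b, n, hn⟩ := exists_coeff l
  simp only [apply_prolong hn] at hl
  simp [coeffProlong, genExpr, Expr.fxx, Expr.fxp, Expr.X, Expr.P, Expr.der_add, Expr.der_mul,
    Expr.der_const, Expr.der_var, Expr.der_fn, Expr.dirIdx, Expr.eval_add, Expr.eval_mul,
    Expr.eval_const, Expr.eval_var, Expr.eval_fn, q_p, crd,
    hess_comm θ 1 0, hess_comm θ 2 0, hess_comm θ 3 0, hess_comm θ 2 1, hess_comm θ 3 1,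
    hess_comm θ 3 2, Fin.sum_univ_four] at hl
  have hc : c = 0 := by simpa using hl nil (quad (θ.1.1 1, θ.1.1 2) 1 0 0 0 0 0) nil nil
  simp only [hc, zero_mul, mul_zero, add_zero, zero_add, neg_zero] at hl
  have hb1 : b 1 = 0 := by simpa using hl nil (quad (θ.1.1 1, θ.1.1 2) 0 1 0 0 0 0) nil nil
  simp only [hb1, zero_mul, mul_zero, add_zero, zero_add, neg_zero] at hl
  have hb2 : b 2 = 0 := by simpa using hl nil (quad (θ.1.1 1, θ.1.1 2) 0 0 1 0 0 0) nil nil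
  simp only [hb2, zero_mul, mul_zero, add_zero, zero_add, neg_zero] at hl
  have n11 : n 1 1 = 0 := by simpa using hl nil (quad (θ.1.1 1, θ.1.1 2) 0 0 0 1 0 0) nil nil
  simp only [n11, zero_mul, mul_zero, add_zero, zero_add, neg_zero] at hl
  have n12 : n 1 2 = 0 := by simpa using hl nil (quad (θ.1.1 1, θ.1.1 2) 0 0 0 0 1 0) nil nil
  simp only [n12, zero_mul, mul_zero, add_zero, zero_add, neg_zero] at hl
  have n22 : n 2 2 = 0 := by simpa using hl nil (quad (θ.1.1 1, θ.1.1 2) 0 0 0 0 0 1) nil nil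
  simp only [n22, zero_mul, mul_zero, add_zero, zero_add, neg_zero] at hl
  have hb0 : b 0 = 0 := by simpa using hl nil nil (quad (θ.1.1 0, θ.1.2.2 0) 0 1 0 0 0 0) nil
  simp only [hb0, zero_mul, mul_zero, add_zero, zero_add, neg_zero] at hl
  have ha0 : a 0 = 0 := by simpa using hl nil nil (quad (θ.1.1 0, θ.1.2.2 0) 0 0 1 0 0 0) nil
  simp only [ha0, zero_mul, mul_zero, add_zero, zero_add, neg_zero] at hl
  have n00 : n 0 0 = 0 := by simpa using hl nil nil (quad (θ.1.1 0, θ.1.2.2 0) 0 0 0 1 0 0) nil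
  simp only [n00, zero_mul, mul_zero, add_zero, zero_add, neg_zero] at hl
  have hb3 : b 3 = 0 := by simpa using hl nil nil nil (quad (θ.1.1 3, θ.1.2.2 3) 0 1 0 0 0 0)
  simp only [hb3, zero_mul, mul_zero, add_zero, zero_add, neg_zero] at hl
  have ha3 : a 3 = 0 := by simpa using hl nil nil nil (quad (θ.1.1 3, θ.1.2.2 3) 0 0 1 0 0 0)
  simp only [ha3, zero_mul, mul_zero, add_zero, zero_add, neg_zero] at hl
  have n33 : n 3 3 = 0 := by simpa using hl nil nil nil (quad (θ.1.1 3, θ.1.2.2 3) 0 0 0 1 0 0)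
  simp only [n33, zero_mul, mul_zero, add_zero, zero_add, neg_zero] at hl
  have ha2 : a 2 = 0 := by simpa using hl (quad (θ.1.1 1, θ.1.1 2) 0 1 0 0 0 0) nil nil nil
  simp only [ha2, zero_mul, mul_zero, add_zero, zero_add, neg_zero] at hl
  have ha1 : a 1 = 0 := by simpa using hl (quad (θ.1.1 1, θ.1.1 2) 0 0 1 0 0 0) nil nil nil
  simp only [ha1, zero_mul, mul_zero, add_zero, zero_add, neg_zero] at hl
  have t1 : n 0 1 * hess θ 0 1 + n 0 2 * hess θ 0 2 + n 0 3 * hess θ 0 3 = 0 := by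
    have h := hl nil nil (quad (θ.1.1 0, θ.1.2.2 0) 0 0 0 0 1 0) nil
    simp only [quad_p, quad_q, quad_apply, nil_p, nil_q, nil_apply] at h
    linarith
  have t2 : n 0 3 * hess θ 0 3 + n 1 3 * hess θ 1 3 + n 2 3 * hess θ 2 3 = 0 := by
    have h := hl nil nil nil (quad (θ.1.1 3, θ.1.2.2 3) 0 0 0 0 1 0)
    simp only [quad_p, quad_q, quad_apply, nil_p, nil_q, nil_apply] at h
    linarith
  have s2 : hess θ 0 3 * (n 1 3 * hess θ 0 1 + n 2 3 * hess θ 0 2) = 0 := by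
    have h := hl nil nil (quad (θ.1.1 0, θ.1.2.2 0) 0 0 0 0 0 1) nil
    simp only [quad_p, quad_q, quad_apply, nil_p, nil_q, nil_apply] at h
    linear_combination h - hess θ 0 0 * t1
  have s1 : hess θ 0 3 * (n 0 1 * hess θ 1 3 + n 0 2 * hess θ 2 3) = 0 := by
    have h := hl nil nil nil (quad (θ.1.1 3, θ.1.2.2 3) 0 0 0 0 0 1)
    simp only [quad_p, quad_q, quad_apply, nil_p, nil_q, nil_apply] at h
    linear_combination h - hess θ 3 3 * t2
  have r4 : n 0 2 * hess θ 0 1 + n 2 3 * hess θ 1 3 = 0 := by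
    have h := hl (quad (θ.1.1 1, θ.1.1 2) 0 0 0 0 0 1) nil nil nil
    simp only [quad_p, quad_q, quad_apply, nil_p, nil_q, nil_apply] at h
    linarith
  have r5 : n 0 1 * hess θ 0 2 + n 1 3 * hess θ 2 3 = 0 := by
    have h := hl (quad (θ.1.1 1, θ.1.1 2) 0 0 0 1 0 0) nil nil nil
    simp only [quad_p, quad_q, quad_apply, nil_p, nil_q, nil_apply] at h
    linarith
  have r6 : n 0 1 * hess θ 0 1 + n 1 3 * hess θ 1 3 - n 0 2 * hess θ 0 2 - n 2 3 * hess θ 2 3 = 0 := by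
    have h := hl (quad (θ.1.1 1, θ.1.1 2) 0 0 0 0 1 0) nil nil nil
    simp only [quad_p, quad_q, quad_apply, nil_p, nil_q, nil_apply] at h
    linarith
  have hd : hess θ 0 3 ≠ 0 := hden
  have hM : hess θ 0 1 ≠ 0 ∨ hess θ 0 2 ≠ 0 ∨ hess θ 1 3 ≠ 0 ∨ hess θ 2 3 ≠ 0 := by
    by_contra! hcon
    obtain ⟨w, hw⟩ := hreg
    exact hw (by simp [numD, invNum, hcon])
  -- The numerator is minus the determinant of the rows (u₁₂, u₁₃), (u₂₄, u₃₄). The remaining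
  -- coefficient `n 0 3` is then fixed by `t1`, as u₁₄ ≠ 0.
  obtain ⟨μ, h1, h2, h3, h4⟩ := eq_smul_cofactor hM
    ((mul_eq_zero.1 s1).resolve_left hd) ((mul_eq_zero.1 s2).resolve_left hd) (by linarith)
    r4 r5 (by linarith)
  rw [hn, hc, hb0, hb1, hb2, hb3, ha0, ha1, ha2, ha3, n00, n11, n12, n22, n33, h1, h2, h3, h4]
  rw [h1, h2] at t1
  simp only [numD, denD, invNum, invDen] at hv
  refine (mul_eq_zero.1 (?_ : hess θ 0 3 * _ = 0)).resolve_left hd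
  linear_combination (-μ) * hv + hess v 0 3 * t1

open PlaneFn in
lemma eq_zero_of_prolong_I (l : J2 →L[ℝ] ℝ) (θ : J2) (hl : ∀ A B C D : PlaneFn,
      l (prolong (fun θ => (genExpr .I A B C D).eval θ) θ) = 0)
    (hreg : ∃ v, numD .I θ v * invDen .I θ - invNum .I θ * denD .I θ v ≠ 0)
    {v : J2} (hv : numD .I θ v * invDen .I θ - invNum .I θ * denD .I θ v = 0) : l v = 0 := by
  obtain ⟨a, c, b, n, hn⟩ := exists_coeff l
  simp only [apply_prolong hn] at hl
  simp [coeffProlong, genExpr, Expr.fxx, Expr.fxp, Expr.X, Expr.P, Expr.der_add, Expr.der_mul,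
    Expr.der_const, Expr.der_var, Expr.der_fn, Expr.dirIdx, Expr.eval_add, Expr.eval_mul,
    Expr.eval_const, Expr.eval_var, Expr.eval_fn, q_p, crd,
    hess_comm θ 1 0, hess_comm θ 2 0, hess_comm θ 3 0, hess_comm θ 2 1, hess_comm θ 3 1,
    hess_comm θ 3 2, Fin.sum_univ_four] at hl
  have hc : c = 0 := by simpa using hl (quad (θ.1.1 0, θ.1.2.2 0) 1 0 0 0 0 0) nil nil nil
  simp only [hc, zero_mul, mul_zero, add_zero, zero_add, neg_zero] at hl
  have hb0 : b 0 = 0 := by simpa using hl (quad (θ.1.1 0, θ.1.2.2 0) 0 1 0 0 0 0) nil nil nil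
  simp only [hb0, zero_mul, mul_zero, add_zero, zero_add, neg_zero] at hl
  have ha0 : a 0 = 0 := by simpa using hl (quad (θ.1.1 0, θ.1.2.2 0) 0 0 1 0 0 0) nil nil nil
  simp only [ha0, zero_mul, mul_zero, add_zero, zero_add, neg_zero] at hl
  have n00 : n 0 0 = 0 := by simpa using hl (quad (θ.1.1 0, θ.1.2.2 0) 0 0 0 1 0 0) nil nil nil
  simp only [n00, zero_mul, mul_zero, add_zero, zero_add, neg_zero] at hl
  have hb1 : b 1 = 0 := by simpa using hl nil (quad (θ.1.1 1, θ.1.2.2 1) 0 1 0 0 0 0) nil nil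
  simp only [hb1, zero_mul, mul_zero, add_zero, zero_add, neg_zero] at hl
  have ha1 : a 1 = 0 := by simpa using hl nil (quad (θ.1.1 1, θ.1.2.2 1) 0 0 1 0 0 0) nil nil
  simp only [ha1, zero_mul, mul_zero, add_zero, zero_add, neg_zero] at hl
  have n11 : n 1 1 = 0 := by simpa using hl nil (quad (θ.1.1 1, θ.1.2.2 1) 0 0 0 1 0 0) nil nil
  simp only [n11, zero_mul, mul_zero, add_zero, zero_add, neg_zero] at hl
  have hb2 : b 2 = 0 := by simpa using hl nil nil (quad (θ.1.1 2, θ.1.2.2 2) 0 1 0 0 0 0) nil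
  simp only [hb2, zero_mul, mul_zero, add_zero, zero_add, neg_zero] at hl
  have ha2 : a 2 = 0 := by simpa using hl nil nil (quad (θ.1.1 2, θ.1.2.2 2) 0 0 1 0 0 0) nil
  simp only [ha2, zero_mul, mul_zero, add_zero, zero_add, neg_zero] at hl
  have n22 : n 2 2 = 0 := by simpa using hl nil nil (quad (θ.1.1 2, θ.1.2.2 2) 0 0 0 1 0 0) nil
  simp only [n22, zero_mul, mul_zero, add_zero, zero_add, neg_zero] at hl
  have hb3 : b 3 = 0 := by simpa using hl nil nil nil (quad (θ.1.1 3, θ.1.2.2 3) 0 1 0 0 0 0)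
  simp only [hb3, zero_mul, mul_zero, add_zero, zero_add, neg_zero] at hl
  have ha3 : a 3 = 0 := by simpa using hl nil nil nil (quad (θ.1.1 3, θ.1.2.2 3) 0 0 1 0 0 0)
  simp only [ha3, zero_mul, mul_zero, add_zero, zero_add, neg_zero] at hl
  have n33 : n 3 3 = 0 := by simpa using hl nil nil nil (quad (θ.1.1 3, θ.1.2.2 3) 0 0 0 1 0 0)
  simp only [n33, zero_mul, mul_zero, add_zero, zero_add, neg_zero] at hl
  have e0 : n 0 1 * hess θ 0 1 + n 0 2 * hess θ 0 2 + n 0 3 * hess θ 0 3 = 0 := by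
    have h := hl (quad (θ.1.1 0, θ.1.2.2 0) 0 0 0 0 1 0) nil nil nil
    simp only [quad_p, quad_q, quad_apply, nil_p, nil_q, nil_apply] at h
    linarith
  have e1 : n 0 1 * hess θ 0 1 + n 1 2 * hess θ 1 2 + n 1 3 * hess θ 1 3 = 0 := by
    have h := hl nil (quad (θ.1.1 1, θ.1.2.2 1) 0 0 0 0 1 0) nil nil
    simp only [quad_p, quad_q, quad_apply, nil_p, nil_q, nil_apply] at h
    linarith
  have e2 : n 0 2 * hess θ 0 2 + n 1 2 * hess θ 1 2 + n 2 3 * hess θ 2 3 = 0 := by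
    have h := hl nil nil (quad (θ.1.1 2, θ.1.2.2 2) 0 0 0 0 1 0) nil
    simp only [quad_p, quad_q, quad_apply, nil_p, nil_q, nil_apply] at h
    linarith
  have e3 : n 0 3 * hess θ 0 3 + n 1 3 * hess θ 1 3 + n 2 3 * hess θ 2 3 = 0 := by
    have h := hl nil nil nil (quad (θ.1.1 3, θ.1.2.2 3) 0 0 0 0 1 0)
    simp only [quad_p, quad_q, quad_apply, nil_p, nil_q, nil_apply] at h
    linarith
  have f0 : n 1 2 * (hess θ 0 1 * hess θ 0 2) + n 1 3 * (hess θ 0 1 * hess θ 0 3) + n 2 3 * (hess θ 0 2 * hess θ 0 3) = 0 := by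
    have h := hl (quad (θ.1.1 0, θ.1.2.2 0) 0 0 0 0 0 1) nil nil nil
    simp only [quad_p, quad_q, quad_apply, nil_p, nil_q, nil_apply] at h
    linear_combination h - hess θ 0 0 * e0
  have f1 : n 0 2 * (hess θ 0 1 * hess θ 1 2) + n 0 3 * (hess θ 0 1 * hess θ 1 3) + n 2 3 * (hess θ 1 2 * hess θ 1 3) = 0 := by
    have h := hl nil (quad (θ.1.1 1, θ.1.2.2 1) 0 0 0 0 0 1) nil nil
    simp only [quad_p, quad_q, quad_apply, nil_p, nil_q, nil_apply] at h
    linear_combination h - hess θ 1 1 * e1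
  have f2 : n 0 1 * (hess θ 0 2 * hess θ 1 2) + n 0 3 * (hess θ 0 2 * hess θ 2 3) + n 1 3 * (hess θ 1 2 * hess θ 2 3) = 0 := by
    have h := hl nil nil (quad (θ.1.1 2, θ.1.2.2 2) 0 0 0 0 0 1) nil
    simp only [quad_p, quad_q, quad_apply, nil_p, nil_q, nil_apply] at h
    linear_combination h - hess θ 2 2 * e2
  have f3 : n 0 1 * (hess θ 0 3 * hess θ 1 3) + n 0 2 * (hess θ 0 3 * hess θ 2 3) + n 1 2 * (hess θ 1 3 * hess θ 2 3) = 0 := by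
    have h := hl nil nil nil (quad (θ.1.1 3, θ.1.2.2 3) 0 0 0 0 0 1)
    simp only [quad_p, quad_q, quad_apply, nil_p, nil_q, nil_apply] at h
    linear_combination h - hess θ 3 3 * e3
  obtain ⟨w, hw⟩ := hreg
  have h := proportional_of_relations e0 e1 e2 e3 f0 f1 f2 f3 (hess v 0 1) (hess v 2 3) (hess v 0 2)
    (hess v 1 3) (hess v 0 3) (hess v 1 2) (hess w 0 1) (hess w 2 3) (hess w 0 2)
    (hess w 1 3) (hess w 0 3) (hess w 1 2)
  rw [hn, hc, hb0, hb1, hb2, hb3, ha0, ha1, ha2, ha3, n00, n11, n22, n33]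
  simp only [numD, denD, invNum, invDen] at hv hw
  refine (mul_eq_zero.1 ?_).resolve_right hw
  linear_combination h + (n 0 1 * hess w 0 1 + n 2 3 * hess w 2 3 + n 0 2 * hess w 0 2
    + n 1 3 * hess w 1 3 + n 0 3 * hess w 0 3 + n 1 2 * hess w 1 2) * hv


/-! The wave equation. -/

lemma fderiv_comp_base {φ : (Fin 4 → ℝ) → ℝ} (hφ : ContDiff ℝ ∞ φ) (θ v : J1) :
    fderiv ℝ (fun θ : J1 => φ θ.1) θ v = fderiv ℝ φ θ.1 v.1 := by
  have h : HasFDerivAt (fun θ : J1 => φ θ.1) _ θ :=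
    (hφ.contDiffAt.differentiableAt (by simp)).hasFDerivAt.comp θ hasFDerivAt_fst
  rw [h.fderiv]
  rfl

lemma totalD2_comp_base {φ : (Fin 4 → ℝ) → ℝ} (hφ : ContDiff ℝ ∞ φ) (i j : Fin 4) (θ : J2) :
    totalD2 i j (fun θ : J1 => φ θ.1) θ =
      fderiv ℝ (fun y => fderiv ℝ φ y (Pi.single j 1)) θ.1.1 (Pi.single i 1) := by
  have h : (fun ϑ : J1 => totalD j (fun θ : J1 => φ θ.1) (ϑ, θ.2)) =
      fun ϑ : J1 => (fun y => fderiv ℝ φ y (Pi.single j 1)) ϑ.1 := by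
    funext ϑ
    exact fderiv_comp_base hφ _ _
  rw [totalD2, h]
  exact fderiv_comp_base ((hφ.fderiv_right (m := ∞) (by simp)).clm_apply contDiff_const) _ _

lemma numD_O_prolong {φ : (Fin 4 → ℝ) → ℝ} (hφ : ContDiff ℝ ∞ φ) (θ : J2) :
    numD .O θ (prolong (fun θ : J1 => φ θ.1) θ) = secondPartial 0 φ θ.1.1
      - secondPartial 1 φ θ.1.1 - secondPartial 2 φ θ.1.1 - secondPartial 3 φ θ.1.1 := by
  simp only [numD, hess_prolong _ _ le_rfl, totalD2_comp_base hφ, secondPartial]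

lemma prolong_comp_base_x {φ : (Fin 4 → ℝ) → ℝ} (hφ : ContDiff ℝ ∞ φ) (θ : J2) (i : Fin 4) :
    (prolong (fun θ : J1 => φ θ.1) θ).1.1 i = 0 := by
  rw [prolong_x, dP, fderiv_comp_base hφ]
  simp

/-- Reduces the wave equation for a polynomial in the xⁱ to symbolic differentiation. It is applied
to 1, xⁱ, xⁱxʲ with i ≠ j and (x¹)² + (xⁱ)², centred at a point, which realize all second order jets
of waves there. -/
lemma eval_mem_sInf_O {e : Expr} (h1 : ∀ θ : J1, e.eval θ = e.eval (θ.1, 0, 0))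
    (h2 : ∀ θ : J2, ((e.der (Expr.dirIdx θ 0)).der (Expr.dirIdx θ 0)).eval θ.1
      - ((e.der (Expr.dirIdx θ 1)).der (Expr.dirIdx θ 1)).eval θ.1
      - ((e.der (Expr.dirIdx θ 2)).der (Expr.dirIdx θ 2)).eval θ.1
      - ((e.der (Expr.dirIdx θ 3)).der (Expr.dirIdx θ 3)).eval θ.1 = 0) :
    (fun θ => e.eval θ) ∈ sInf .O := by
  have hφ : ContDiff ℝ ∞ fun y : Fin 4 → ℝ => e.eval (y, 0, 0) :=
    e.contDiff_eval.comp (contDiff_id.prodMk contDiff_const)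
  have h3 : (fun θ => e.eval θ) = fun θ : J1 => e.eval (θ.1, 0, 0) := funext h1
  refine ⟨_, ⟨hφ, fun x => ?_⟩, h3⟩
  have := h2 ((x, 0, 0), 0)
  rw [← Expr.totalD2_eval, ← Expr.totalD2_eval, ← Expr.totalD2_eval, ← Expr.totalD2_eval, h3] at this
  simp only [totalD2_comp_base hφ] at this
  exact this

/-- The shifted coordinate `xⁱ - c`. -/
def Expr.shift (i : Fin 4) (c : ℝ) : Expr := X i + const (-c)

lemma const_mem_sInf_O (c : ℝ) : (fun θ => (Expr.const c).eval θ) ∈ sInf .O := by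
  refine eval_mem_sInf_O (fun _ => rfl) fun θ => ?_
  simp [Expr.der_const, Expr.eval_const]

lemma shift_mem_sInf_O (i : Fin 4) (c : ℝ) : (fun θ => (Expr.shift i c).eval θ) ∈ sInf .O := by
  refine eval_mem_sInf_O (fun _ => rfl) fun θ => ?_
  simp [Expr.shift, Expr.X, Expr.der_const, Expr.der_add,
    Expr.der_var, Expr.eval_const, Expr.eval_add]

lemma shift_mul_shift_mem_sInf_O {i j : Fin 4} (hij : i ≠ j) (c d : ℝ) :
    (fun θ => (Expr.shift i c * Expr.shift j d).eval θ) ∈ sInf .O := by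
  refine eval_mem_sInf_O (fun _ => rfl) fun θ => ?_
  have : ∀ k, (Pi.single k 1 : Fin 4 → ℝ) i * (Pi.single k 1 : Fin 4 → ℝ) j = 0 := by
    intro k
    rcases eq_or_ne i k with rfl | h
    · simp [hij.symm]
    · simp [h]
  simp [Expr.shift, Expr.X, Expr.der_const, Expr.der_add,
    Expr.der_mul, Expr.dirIdx, Expr.der_var, Expr.eval_mul, Expr.eval_const, Expr.eval_add, this]

lemma shift_sq_add_shift_sq_mem_sInf_O {i : Fin 4} (hi : i ≠ 0) (c d : ℝ) :
    (fun θ => (Expr.shift 0 c * Expr.shift 0 c + Expr.shift i d * Expr.shift i d).eval θ)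
      ∈ sInf .O := by
  refine eval_mem_sInf_O (fun _ => rfl) fun θ => ?_
  fin_cases i
  · exact absurd rfl hi
  all_goals
    simp [Expr.shift, Expr.X, Expr.der_const, Expr.der_add,
      Expr.der_mul, Expr.dirIdx, Expr.der_var, Expr.eval_mul, Expr.eval_const, Expr.eval_add]

/-- The fields have no xⁱ components, so the tests say nothing about the coefficients `a i`; this is
why v is assumed to have none. On such v the tests make l equal to `n 0 0` times dI. -/
lemma eq_zero_of_prolong_O (l : J2 →L[ℝ] ℝ) (θ : J2) (hl : ∀ f ∈ sInf .O, l (prolong f θ) = 0)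
    {v : J2} (hx : ∀ i, v.1.1 i = 0) (hv : numD .O θ v = 0) : l v = 0 := by
  obtain ⟨a, c, b, n, hn⟩ := exists_coeff l
  have hc : c = 0 := by
    have h := hl _ (const_mem_sInf_O 1)
    rw [apply_prolong hn] at h
    simpa [coeffProlong, Expr.der_const, Expr.eval_const] using h
  have hb : ∀ i, b i = 0 := by
    intro i
    have h := hl _ (shift_mem_sInf_O i (θ.1.1 i))
    rw [apply_prolong hn] at h
    simpa [coeffProlong, hc, Expr.shift, Expr.X, Expr.der_const, Expr.eval_const, Expr.der_add,
      Expr.eval_add, Expr.der_var, Pi.single_apply] using h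
  have hij : ∀ i j, i < j → n i j = 0 := by
    intro i j h
    have h := hl _ (shift_mul_shift_mem_sInf_O h.ne (θ.1.1 i) (θ.1.1 j))
    rw [apply_prolong hn] at h
    fin_cases i <;> fin_cases j <;> first
      | exact absurd ‹_ < _› (by decide)
      | simpa [coeffProlong, hc, Expr.shift, Expr.X, Expr.der_const, Expr.eval_const, Expr.der_add,
        Expr.eval_add, Expr.der_mul, Expr.eval_mul, Expr.eval_var, crd, Expr.dirIdx,
        Expr.der_var] using h
  have hii : ∀ i, i ≠ 0 → n 0 0 + n i i = 0 := by
    intro i hi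
    have h := hl _ (shift_sq_add_shift_sq_mem_sInf_O hi (θ.1.1 0) (θ.1.1 i))
    rw [apply_prolong hn] at h
    fin_cases i
    · exact absurd rfl hi
    all_goals
      simp [coeffProlong, hc, Expr.shift, Expr.X, Expr.der_const, Expr.eval_const, Expr.der_add,
        Expr.eval_add, Expr.der_mul, Expr.eval_mul, Expr.eval_var, crd, Expr.dirIdx,
        Expr.der_var] at h
      simp
      linarith
  simp only [numD] at hv
  simp only [hn, hc, hx, hb, hij 0 1 (by decide), hij 0 2 (by decide), hij 0 3 (by decide),
    hij 1 2 (by decide), hij 1 3 (by decide), hij 2 3 (by decide)]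
  linear_combination n 0 0 * hv + hess v 1 1 * hii 1 (by decide) + hess v 2 2 * hii 2 (by decide)
    + hess v 3 3 * hii 3 (by decide)

/-! All types. -/

/-- The symmetries scale the numerator and the denominator of the invariant by the same factor. -/
lemma exists_scale {τ : MAType} {f : J1 → ℝ} (hf : f ∈ sInf τ) (θ : J2) :
    ∃ μ, numD τ θ (prolong f θ) = μ * invNum τ θ ∧ denD τ θ (prolong f θ) = μ * invDen τ θ := by
  rcases eq_or_ne τ .O with rfl | hτ
  · obtain ⟨φ, hφ, rfl⟩ := hf
    exact ⟨0, by rw [numD_O_prolong hφ.1, hφ.2, zero_mul], by simp [denD]⟩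
  · obtain ⟨A, B, C, D, rfl⟩ := (mem_sInf_iff hτ f).1 hf
    cases τ
    · exact absurd rfl hτ
    · exact ⟨0, by rw [scale_N, zero_mul], by simp [denD]⟩
    · exact ⟨0, by rw [scale_D, zero_mul], by simp [denD]⟩
    · exact ⟨_, scale_III A B C D θ⟩
    · exact ⟨_, scale_II A B C D θ⟩
    · exact ⟨_, scale_I A B C D θ⟩

lemma contDiff_of_mem_sInf {τ : MAType} {f : J1 → ℝ} (hf : f ∈ sInf τ) : ContDiff ℝ ∞ f := by
  rcases eq_or_ne τ .O with rfl | hτ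
  · obtain ⟨φ, hφ, rfl⟩ := hf
    exact hφ.1.comp contDiff_fst
  · obtain ⟨A, B, C, D, rfl⟩ := (mem_sInf_iff hτ f).1 hf
    exact Expr.contDiff_eval _

theorem isInvariant2_inv (τ : MAType) : IsInvariant2 (sInf τ) (dom τ) (inv τ) := by
  refine ⟨contDiffOn_inv τ, fun f hf θ hθ => ?_⟩
  obtain ⟨μ, h1, h2⟩ := exists_scale hf θ
  rw [fderiv_inv_eq_zero_iff hθ, h1, h2]
  ring

lemma exists_ne_zero_of_mem_reg {τ : MAType} {θ : J2} (hθ : θ ∈ reg τ) :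
    ∃ v, numD τ θ v * invDen τ θ - invNum τ θ * denD τ θ v ≠ 0 := by
  by_contra! hcon
  exact hθ.2 (ContinuousLinearMap.ext fun v => (fderiv_inv_eq_zero_iff hθ.1 v).2 (hcon v))

lemma mem_reg_of_ne_zero {τ : MAType} {θ : J2} (hθ : θ ∈ dom τ) (v : J2)
    (hv : numD τ θ v * invDen τ θ - invNum τ θ * denD τ θ v ≠ 0) : θ ∈ reg τ := by
  refine ⟨hθ, fun h => hv ?_⟩
  rw [← fderiv_inv_eq_zero_iff hθ, h]
  rfl

/-- At a regular point of the invariant the prolonged fields span the kernel of its differential. -/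
theorem eq_zero_of_prolong {τ : MAType} (hτ : τ ≠ .O) {θ : J2} (hθ : θ ∈ reg τ) (l : J2 →L[ℝ] ℝ)
    (hl : ∀ f ∈ sInf τ, l (prolong f θ) = 0) {v : J2} (hv : fderiv ℝ (inv τ) θ v = 0) : l v = 0 := by
  rw [fderiv_inv_eq_zero_iff hθ.1] at hv
  have hreg := exists_ne_zero_of_mem_reg hθ
  have hl' := fun A B C D => hl _ ((mem_sInf_iff hτ _).2 ⟨A, B, C, D, rfl⟩)
  cases τ
  · exact absurd rfl hτ
  · exact eq_zero_of_prolong_N l θ hl' (by simpa [denD, invDen] using hv)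
  · exact eq_zero_of_prolong_D l θ hl' (by simpa [denD, invDen] using hreg)
      (by simpa [denD, invDen] using hv)
  · exact eq_zero_of_prolong_III l θ hl' hθ.1 hv
  · exact eq_zero_of_prolong_II l θ hl' hθ.1 hreg hv
  · exact eq_zero_of_prolong_I l θ hl' hreg hv

/-! The equations in terms of the numerator and the denominator of the invariant. -/

/-- The coefficients of the numerator and the denominator of the invariant in the equation. -/
def lvlCoeff (α β : ℝ) : MAType → ℝ × ℝ
  | .O => (1, 0)
  | .N => (1, 0)
  | .D => (1, -1)
  | .III => (1, 0)
  | .II => (-1, 1)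
  | .I => (-β, α + β)

lemma equationFn_eq (α β : ℝ) (τ : MAType) :
    equationFn α β τ = fun θ =>
      (lvlCoeff α β τ).1 * invNum τ θ + (lvlCoeff α β τ).2 * invDen τ θ := by
  funext θ
  cases τ <;> simp only [equationFn, lvlCoeff, invNum, invDen] <;> ring

/-- The value of the invariant on the equation. -/
def lvl (α β : ℝ) : MAType → ℝ
  | .O => 0
  | .N => 0
  | .D => 1
  | .III => 0
  | .II => 1
  | .I => (α + β) / β

lemma equationFn_eq_zero_iff {α β : ℝ} (hβ : β ≠ 0) {τ : MAType} {θ : J2} (hθ : θ ∈ dom τ) :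
    equationFn α β τ θ = 0 ↔ inv τ θ = lvl α β τ := by
  have hd : invDen τ θ ≠ 0 := hθ
  rw [inv, div_eq_iff hd, equationFn_eq]
  cases τ
  case I =>
    simp only [lvlCoeff, lvl]
    rw [div_mul_eq_mul_div, eq_div_iff hβ]
    constructor <;> intro h <;> linarith
  all_goals
    simp only [lvlCoeff, lvl]
    constructor <;> intro h <;> linarith

/-- The equation is F = 0 with F a constant combination of numerator and denominator, so a symmetry
maps F to μF. This also covers points of the equation outside `dom`. -/
theorem sInf_subset_contactSymmetries (α β : ℝ) (τ : MAType) :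
    sInf τ ⊆ contactSymmetries (equationFn α β τ) := by
  intro f hf
  refine ⟨contDiff_of_mem_sInf hf, fun θ h0 => ?_⟩
  obtain ⟨μ, h1, h2⟩ := exists_scale hf θ
  have hn := (contDiff_invNum τ).contDiffAt.differentiableAt (x := θ) (by simp)
  have hd := (contDiff_invDen τ).contDiffAt.differentiableAt (x := θ) (by simp)
  have h : HasFDerivAt (equationFn α β τ) ((lvlCoeff α β τ).1 • fderiv ℝ (invNum τ) θ
      + (lvlCoeff α β τ).2 • fderiv ℝ (invDen τ) θ) θ := by
    rw [equationFn_eq]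
    exact (hn.hasFDerivAt.const_mul (lvlCoeff α β τ).1).add
      (hd.hasFDerivAt.const_mul (lvlCoeff α β τ).2)
  rw [equationFn_eq] at h0
  rw [h.fderiv]
  simp only [add_apply, smul_apply, fderiv_invNum, fderiv_invDen, smul_eq_mul, h1, h2]
  linear_combination μ * h0

theorem level_I_eq {α β : ℝ} (hβ : β ≠ 0) :
    level .I ((α + β) / β) = equation α β .I ∩ dom .I := by
  ext θ
  constructor
  · rintro ⟨hd, h⟩
    exact ⟨(equationFn_eq_zero_iff hβ hd).2 h, hd⟩
  · rintro ⟨h, hd⟩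
    exact ⟨hd, (equationFn_eq_zero_iff hβ hd).1 h⟩

/-! Density. -/

lemma eventually_sq_add_ne_zero (b c : ℝ) : ∀ᶠ s in 𝓝[≠] (0 : ℝ), s ^ 2 + b * s + c ≠ 0 := by
  have hp : (Polynomial.X ^ 2 + Polynomial.C b * Polynomial.X + Polynomial.C c : Polynomial ℝ) ≠ 0 := by
    intro h
    have := congrArg (fun p => Polynomial.coeff p 2) h
    simp at this
  have hfin := Polynomial.finite_setOf_isRoot hp
  filter_upwards [nhdsNE_le_cofinite 0 hfin.compl_mem_cofinite] with s hs h0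
  apply hs
  simpa [Polynomial.IsRoot] using h0

lemma eventually_add_ne_zero (c : ℝ) : ∀ᶠ s in 𝓝[≠] (0 : ℝ), c + s ≠ 0 := by
  filter_upwards [nhdsNE_le_cofinite 0 (Set.finite_singleton (-c)).compl_mem_cofinite] with s hs h0
  exact hs (by simp; linarith)

lemma mem_closure_of_path {E : Set J2} {θ : J2} (γ : ℝ → Sym2 (Fin 4) → ℝ) (hγ : Continuous γ)
    (h0 : γ 0 = θ.2) (h : ∀ᶠ s in 𝓝[≠] (0 : ℝ), ((θ.1, γ s) : J2) ∈ E) : θ ∈ closure E := by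
  refine mem_closure_of_tendsto (f := fun s => ((θ.1, γ s) : J2)) (b := 𝓝[≠] (0 : ℝ)) ?_ h
  have hc : Continuous fun s => ((θ.1, γ s) : J2) := continuous_const.prodMk hγ
  have := hc.tendsto 0
  simp only [h0] at this
  exact this.mono_left nhdsWithin_le_nhds

/-- The tangent vector `∂_{uᵢⱼ}`. -/
def dS (i j : Fin 4) : J2 := (0, Pi.single s(i, j) 1)

lemma mem_reg_O (θ : J2) : θ ∈ reg .O := by
  refine mem_reg_of_ne_zero (by simp [dom, invDen]) (dS 0 0) ?_
  simp [numD, denD, invDen, dS, hess]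

lemma mem_reg_N (θ : J2) : θ ∈ reg .N := by
  refine mem_reg_of_ne_zero (by simp [dom, invDen]) (dS 1 3) ?_
  simp [numD, denD, invDen, dS, hess]

lemma mem_reg_D {θ : J2} (h : hess θ 0 2 ≠ 0) : θ ∈ reg .D := by
  refine mem_reg_of_ne_zero (by simp [dom, invDen]) (dS 1 3) ?_
  simpa [numD, denD, invDen, dS, hess] using h

lemma mem_reg_III {θ : J2} (h : hess θ 2 3 ≠ 0) : θ ∈ reg .III := by
  refine mem_reg_of_ne_zero h (dS 1 3) ?_
  simpa [numD, denD, invDen, dS, hess] using h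

lemma mem_reg_II {θ : J2} (h : hess θ 0 3 ≠ 0) (h' : hess θ 0 2 ≠ 0) : θ ∈ reg .II := by
  refine mem_reg_of_ne_zero h (dS 1 3) ?_
  simpa [numD, denD, invDen, dS, hess] using ⟨h', h⟩

lemma mem_reg_I {θ : J2} (h : hess θ 0 1 * hess θ 2 3 - hess θ 0 3 * hess θ 1 2 ≠ 0)
    (h' : hess θ 0 2 ≠ 0) : θ ∈ reg .I := by
  refine mem_reg_of_ne_zero h (dS 1 3) ?_
  simpa [numD, denD, invDen, dS, hess] using ⟨h', h⟩

theorem dense_reg (τ : MAType) : Dense (reg τ) := by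
  intro θ
  cases τ with
  | O => exact subset_closure (mem_reg_O θ)
  | N => exact subset_closure (mem_reg_N θ)
  | D =>
    refine mem_closure_of_path (fun s e => θ.2 e + s) (by fun_prop) (by simp) ?_
    filter_upwards [eventually_add_ne_zero (hess θ 0 2)] with s h
    exact mem_reg_D h
  | III =>
    refine mem_closure_of_path (fun s e => θ.2 e + s) (by fun_prop) (by simp) ?_
    filter_upwards [eventually_add_ne_zero (hess θ 2 3)] with s h
    exact mem_reg_III h
  | II =>
    refine mem_closure_of_path (fun s e => θ.2 e + s) (by fun_prop) (by simp) ?_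
    filter_upwards [eventually_add_ne_zero (hess θ 0 3), eventually_add_ne_zero (hess θ 0 2)]
      with s h h'
    exact mem_reg_II h h'
  | I =>
    -- Along this line the denominator is a monic quadratic polynomial in s, and u₁₃ is moved away
    -- from zero.
    refine mem_closure_of_path (fun s e => θ.2 e + s * if e = s(0, 1) ∨ e = s(2, 3) ∨ e = s(0, 2)
      then 1 else 0) (by fun_prop) (by simp) ?_
    filter_upwards [eventually_add_ne_zero (hess θ 0 2), eventually_sq_add_ne_zero
      (hess θ 0 1 + hess θ 2 3) (hess θ 0 1 * hess θ 2 3 - hess θ 0 3 * hess θ 1 2)] with s h h'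
    refine mem_reg_I ?_ ?_
    · intro h0
      apply h'
      simp [hess] at h0 ⊢
      linarith
    · simpa [hess] using h

/-- The increment is quadratic in s because, when both factors vanish, both have to move. -/
lemma exists_mul_path (p q k : ℝ) : ∃ f g : ℝ → ℝ, Continuous f ∧ Continuous g ∧ f 0 = p ∧ g 0 = q ∧
    ∀ s, f s * g s = p * q + k * s ^ 2 := by
  by_cases hp : p = 0
  · by_cases hq : q = 0
    · refine ⟨fun s => s, fun s => k * s, by fun_prop, by fun_prop, by simp [hp], by simp [hq], ?_⟩
      intro s
      rw [hp]
      ring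
    · refine ⟨fun s => p + k * s ^ 2 / q, fun _ => q, by fun_prop, by fun_prop, by simp, rfl, ?_⟩
      intro s
      field_simp
  · refine ⟨fun _ => p, fun s => q + k * s ^ 2 / p, by fun_prop, by fun_prop, rfl, by simp, ?_⟩
    intro s
    field_simp

/-- A point where the denominator vanishes is moved along a curve inside the equation on which the
denominator is nonzero for small s ≠ 0. -/
theorem equation_subset_closure (α β : ℝ) (hβ : β ≠ 0) (τ : MAType) :
    equation α β τ ⊆ closure (equation α β τ ∩ dom τ) := by
  intro θ hθ
  by_cases hd : θ ∈ dom τ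
  · exact subset_closure ⟨hθ, hd⟩
  simp only [dom, Set.mem_ofPred_eq, not_not] at hd
  have h0 : equationFn α β τ θ = 0 := hθ
  cases τ with
  | O => simp [invDen] at hd
  | N => simp [invDen] at hd
  | D => simp [invDen] at hd
  | III =>
    -- The change of u₂₄ compensates the change s·u₁₃ of u₁₃u₃₄.
    refine mem_closure_of_path (fun s e => θ.2 e + s * (if e = s(2, 3) then 1 else 0)
      - s * hess θ 0 2 * (if e = s(1, 3) then 1 else 0)) (by fun_prop) (by simp) ?_
    filter_upwards [eventually_add_ne_zero (hess θ 2 3)] with s h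
    refine ⟨?_, ?_⟩
    · simp only [equationFn] at h0
      simp [equation, equationFn]
      simp [hess] at h0 ⊢
      linarith
    · simpa [dom, invDen, hess] using h
  | II =>
    -- The correction of u₁₄ is the increment of u₁₃u₂₄ when both factors grow by s.
    refine mem_closure_of_path (fun s e => θ.2 e + s * (if e = s(0, 2) ∨ e = s(1, 3) then 1 else 0)
      + (s ^ 2 + (hess θ 0 2 + hess θ 1 3) * s) * (if e = s(0, 3) then 1 else 0))
      (by fun_prop) (by simp) ?_
    filter_upwards [eventually_sq_add_ne_zero (hess θ 0 2 + hess θ 1 3) (hess θ 0 3)] with s h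
    refine ⟨?_, ?_⟩
    · simp only [equationFn] at h0
      simp [equation, equationFn]
      simp [hess] at h0 ⊢
      linarith
    · intro h1
      apply h
      simp [invDen, hess] at h1 ⊢
      linarith
  | I =>
    -- The increments βs² of u₁₂u₃₄ and -αs² of u₁₃u₂₄ cancel in the equation, while the denominator
    -- grows by βs².
    obtain ⟨f, g, hf, hg, hf0, hg0, hfg⟩ := exists_mul_path (hess θ 0 1) (hess θ 2 3) β
    obtain ⟨f', g', hf', hg', hf0', hg0', hfg'⟩ := exists_mul_path (hess θ 0 2) (hess θ 1 3) (-α)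
    refine mem_closure_of_path (fun s e => if e = s(0, 1) then f s else if e = s(2, 3) then g s else
      if e = s(0, 2) then f' s else if e = s(1, 3) then g' s else θ.2 e) ?_ ?_ ?_
    · refine continuous_pi fun e => ?_
      split_ifs <;> fun_prop
    · funext e
      split_ifs with h1 h2 h3 h4 <;> simp_all [hess]
    · filter_upwards [self_mem_nhdsWithin] with s hs
      refine ⟨?_, ?_⟩
      · simp only [equationFn] at h0
        simp [equation, equationFn, hess] at h0 ⊢
        simp [hfg, hfg', hess]
        linarith
      · intro h1
        simp [invDen, hess] at hd h1
        simp [hfg, hess] at h1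
        have : β * s ^ 2 = 0 := by linarith
        simp only [mul_eq_zero, hβ, false_or] at this
        exact hs (pow_eq_zero_iff (by norm_num) |>.1 this)

/-! Contact equivalences. -/

/-- The dual description by the contact forms du - ∑ uᵢ dxⁱ and duₖ - ∑ uᵢₖ dxⁱ: the coefficients of
the `dir i` are the xⁱ components of v. -/
lemma mem_cartan_iff (θ v : J2) : v ∈ cartan θ ↔ v.1.2.1 = ∑ i, θ.1.2.2 i * v.1.1 i ∧
    ∀ k, v.1.2.2 k = ∑ i, v.1.1 i * hess θ i k := by
  constructor
  · rintro ⟨a, ha⟩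
    have h1 : v.1.1 = a := by
      rw [ha]
      funext k
      fin_cases k <;> simp [dir, Fin.sum_univ_four]
    rw [h1, ha]
    refine ⟨?_, fun k => ?_⟩
    · simp [dir, Fin.sum_univ_four]
      ring
    · simp [dir, Fin.sum_univ_four]
  · rintro ⟨h1, h2⟩
    refine ⟨v.1.1, ?_⟩
    refine Prod.ext ?_ (Prod.ext ?_ ?_)
    · funext k
      fin_cases k <;> simp [dir, Fin.sum_univ_four]
    · rw [h1]
      simp [dir, Fin.sum_univ_four]
      ring
    · funext k
      rw [h2]
      simp [dir, Fin.sum_univ_four]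

/-- The product of the two values of a function at an unordered pair. -/
def pairProd (ε : Fin 4 → ℝ) : Sym2 (Fin 4) → ℝ :=
  Sym2.lift ⟨fun i j => ε i * ε j, fun _ _ => mul_comm _ _⟩

lemma pairProd_ne_zero {ε : Fin 4 → ℝ} (hε : ∀ i, ε i ≠ 0) (s : Sym2 (Fin 4)) : pairProd ε s ≠ 0 := by
  induction s with
  | _ i j => exact mul_ne_zero (hε i) (hε j)

/-- The prolongation to `J²` of the scaling `xⁱ ↦ εᵢ xⁱ`. -/
def scaling (ε : Fin 4 → ℝ) (hε : ∀ i, ε i ≠ 0) : J2 ≃ₗ[ℝ] J2 where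
  toFun θ := ((fun i => ε i * θ.1.1 i, θ.1.2.1, fun i => (ε i)⁻¹ * θ.1.2.2 i),
    fun s => (pairProd ε s)⁻¹ * θ.2 s)
  invFun θ := ((fun i => (ε i)⁻¹ * θ.1.1 i, θ.1.2.1, fun i => ε i * θ.1.2.2 i),
    fun s => pairProd ε s * θ.2 s)
  map_add' θ θ' := by ext <;> simp <;> ring
  map_smul' c θ := by ext <;> simp <;> ring
  left_inv θ := by ext <;> simp [hε, pairProd_ne_zero hε]
  right_inv θ := by ext <;> simp [hε, pairProd_ne_zero hε]

lemma hess_scaling (ε : Fin 4 → ℝ) (hε : ∀ i, ε i ≠ 0) (θ : J2) (i j : Fin 4) :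
    hess (scaling ε hε θ) i j = (ε i)⁻¹ * (ε j)⁻¹ * hess θ i j := by
  change (ε i * ε j)⁻¹ * θ.2 s(i, j) = _
  rw [mul_inv, hess]

lemma scaling_mem_cartan_iff (ε : Fin 4 → ℝ) (hε : ∀ i, ε i ≠ 0) (θ v : J2) :
    v ∈ cartan θ ↔ scaling ε hε v ∈ cartan (scaling ε hε θ) := by
  rw [mem_cartan_iff, mem_cartan_iff]
  have h1 : (scaling ε hε v).1.2.1 = v.1.2.1 := rfl
  have h2 : ∀ i, (scaling ε hε v).1.1 i = ε i * v.1.1 i := fun _ => rfl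
  have h3 : ∀ (w : J2) i, (scaling ε hε w).1.2.2 i = (ε i)⁻¹ * w.1.2.2 i := fun _ _ => rfl
  simp only [h1, h2, h3, hess_scaling]
  refine and_congr (Eq.congr_right (Finset.sum_congr rfl fun i _ => ?_)) (forall_congr' fun k => ?_)
  · have := hε i
    field_simp
  · have hs : ∑ i, ε i * v.1.1 i * ((ε i)⁻¹ * (ε k)⁻¹ * hess θ i k)
        = (ε k)⁻¹ * ∑ i, v.1.1 i * hess θ i k := by
      rw [Finset.mul_sum]
      refine Finset.sum_congr rfl fun i _ => ?_
      have := hε i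
      field_simp
    rw [hs]
    exact (mul_right_inj' (inv_ne_zero (hε k))).symm

lemma image_eq_of_mem_iff {Φ : J2 ≃ J2} {A B : Set J2} (h : ∀ θ, θ ∈ A ↔ Φ θ ∈ B) : Φ '' A = B := by
  ext θ
  rw [Equiv.image_eq_preimage_symm, Set.mem_preimage, h, Equiv.apply_symm_apply]

lemma contactEquivalent_of_scaling (ε : Fin 4 → ℝ) (hε : ∀ i, ε i ≠ 0) {A B : Set J2}
    (h : ∀ θ, θ ∈ A ↔ scaling ε hε θ ∈ B) : ContactEquivalent A B := by
  let T := (scaling ε hε).toContinuousLinearEquiv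
  refine ⟨(scaling ε hε).toEquiv, T.contDiff, T.symm.contDiff, fun θ v => ?_, image_eq_of_mem_iff h⟩
  have : fderiv ℝ (scaling ε hε).toEquiv θ v = scaling ε hε v :=
    congrArg (fun S : J2 →L[ℝ] J2 => S v) (T : J2 →L[ℝ] J2).fderiv
  rw [this]
  exact scaling_mem_cartan_iff ε hε θ v

/-- The prolongation to `J²` of the transformation that adds the quadratic form `½ ∑ Qᵢⱼ xⁱ xʲ` to `u`. -/
def quadShift (Q : Sym2 (Fin 4) → ℝ) (θ : J2) : J2 :=
  ((θ.1.1, θ.1.2.1 + 1 / 2 * ∑ i, ∑ j, Q s(i, j) * (θ.1.1 i * θ.1.1 j),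
    fun k => θ.1.2.2 k + ∑ j, Q s(k, j) * θ.1.1 j), fun s => θ.2 s + Q s)

/-- The derivative of `quadShift Q` at `θ`. -/
def quadShiftD (Q : Sym2 (Fin 4) → ℝ) (θ v : J2) : J2 :=
  ((v.1.1, v.1.2.1 + ∑ i, ∑ j, Q s(i, j) * (θ.1.1 i * v.1.1 j),
    fun k => v.1.2.2 k + ∑ j, Q s(k, j) * v.1.1 j), v.2)

lemma contDiff_quadShift (Q : Sym2 (Fin 4) → ℝ) : ContDiff ℝ ∞ (quadShift Q) := by
  unfold quadShift
  fun_prop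

lemma quadShift_neg (Q : Sym2 (Fin 4) → ℝ) (θ : J2) : quadShift (-Q) (quadShift Q θ) = θ := by
  refine Prod.ext (Prod.ext rfl (Prod.ext ?_ ?_)) ?_
  · simp [quadShift]
  · funext k
    simp [quadShift]
  · funext s
    simp [quadShift]

/-- `quadShift Q` as a bijection. -/
def quadShiftEquiv (Q : Sym2 (Fin 4) → ℝ) : J2 ≃ J2 where
  toFun := quadShift Q
  invFun := quadShift (-Q)
  left_inv := quadShift_neg Q
  right_inv θ := by simpa using quadShift_neg (-Q) θ

lemma fderiv_quadShift (Q : Sym2 (Fin 4) → ℝ) (θ v : J2) :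
    fderiv ℝ (quadShift Q) θ v = quadShiftD Q θ v := by
  let M : J2 := ((0, 1 / 2 * ∑ i, ∑ j, Q s(i, j) * (v.1.1 i * v.1.1 j), 0), 0)
  -- The map is polynomial of degree two, so its expansion along a line is exact and the derivative
  -- is the coefficient of t.
  have h1 : ∀ t : ℝ, quadShift Q (θ + t • v) = quadShift Q θ + t • quadShiftD Q θ v + t ^ 2 • M := by
    intro t
    have hs : ∀ i j, Q s(i, j) = Q s(j, i) := fun i j => by rw [Sym2.eq_swap]
    refine Prod.ext (Prod.ext ?_ (Prod.ext ?_ ?_)) ?_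
    · simp [quadShift, quadShiftD, M]
    · simp only [quadShift, quadShiftD, M, Fin.sum_univ_four, Prod.fst_add, Prod.snd_add,
        Prod.smul_fst, Prod.smul_snd, Pi.add_apply, Pi.smul_apply, smul_eq_mul,
        hs 1 0, hs 2 0, hs 3 0, hs 2 1, hs 3 1, hs 3 2]
      ring
    · funext k
      simp [quadShift, quadShiftD, M, Fin.sum_univ_four]
      ring
    · funext s
      simp [quadShift, quadShiftD, M]
      ring
  have h2 : HasDerivAt (fun t : ℝ => quadShift Q (θ + t • v)) (quadShiftD Q θ v) 0 := by
    simp only [h1]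
    have h3 := (((hasDerivAt_id (0 : ℝ)).smul_const (quadShiftD Q θ v)).const_add
      (quadShift Q θ)).add (((hasDerivAt_id (0 : ℝ)).pow 2).smul_const M)
    exact h3.congr_deriv (by simp)
  have h4 : HasDerivAt (fun t : ℝ => quadShift Q (θ + t • v)) (fderiv ℝ (quadShift Q) θ v) 0 := by
    have h5 : HasDerivAt (fun t : ℝ => θ + t • v) v 0 := by
      simpa using ((hasDerivAt_id (0 : ℝ)).smul_const v).const_add θ
    have h6 : HasFDerivAt (quadShift Q) (fderiv ℝ (quadShift Q) θ) (θ + (0 : ℝ) • v) := by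
      rw [zero_smul, add_zero]
      exact ((contDiff_quadShift Q).contDiffAt.differentiableAt (by simp)).hasFDerivAt
    exact h6.comp_hasDerivAt 0 h5
  exact h4.unique h2

lemma hess_quadShift (Q : Sym2 (Fin 4) → ℝ) (θ : J2) (i j : Fin 4) :
    hess (quadShift Q θ) i j = hess θ i j + Q s(i, j) := rfl

lemma contactEquivalent_of_quadShift (Q : Sym2 (Fin 4) → ℝ) {A B : Set J2}
    (h : ∀ θ, θ ∈ A ↔ quadShift Q θ ∈ B) : ContactEquivalent A B := by
  refine ⟨quadShiftEquiv Q, contDiff_quadShift Q, contDiff_quadShift (-Q), fun θ v => ?_,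
    image_eq_of_mem_iff h⟩
  change _ ↔ fderiv ℝ (quadShift Q) θ v ∈ cartan (quadShift Q θ)
  rw [fderiv_quadShift, mem_cartan_iff, mem_cartan_iff]
  have hs : ∀ i j, Q s(i, j) = Q s(j, i) := fun i j => by rw [Sym2.eq_swap]
  refine and_congr ?_ (forall_congr' fun k => ?_)
  · simp only [quadShift, quadShiftD, Fin.sum_univ_four,
      hs 1 0, hs 2 0, hs 3 0, hs 2 1, hs 3 1, hs 3 2]
    constructor <;> intro h <;> linarith
  · simp only [hess_quadShift]
    simp only [quadShiftD, Fin.sum_univ_four, hs k]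
    constructor <;> intro h <;> linarith

/-- In types O, N, III subtracting c from u₁₁, u₂₄, u₁₃ respectively lowers I by c. In types D and
II scaling x¹, respectively x², by c divides I by c, since that index occurs once in every term of
the numerator and not in the denominator. -/
theorem contactEquivalent_level (α β : ℝ) {τ : MAType} (hτ : τ ≠ .I) (c : ℝ)
    (hc : (τ = .D ∨ τ = .II) → c ≠ 0) :
    ContactEquivalent (level τ c) (equation α β τ ∩ dom τ) := by
  cases τ with
  | O =>
    refine contactEquivalent_of_quadShift (Pi.single s(0, 0) (-c)) fun θ => ?_
    simp [level, dom, equation, inv, invNum, invDen, equationFn, hess_quadShift]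
    constructor <;> intro h <;> linarith
  | N =>
    refine contactEquivalent_of_quadShift (Pi.single s(1, 3) (-c)) fun θ => ?_
    simp [level, dom, equation, inv, invNum, invDen, equationFn, hess_quadShift]
    constructor <;> intro h <;> linarith
  | III =>
    refine contactEquivalent_of_quadShift (Pi.single s(0, 2) (-c)) fun θ => ?_
    simp [level, dom, equation, inv, invNum, invDen, equationFn, hess_quadShift]
    rw [and_comm]
    refine and_congr_left fun h => ?_
    rw [div_eq_iff h]
    constructor <;> intro h <;> linarith
  | D =>
    have hc' := hc (.inl rfl)
    refine contactEquivalent_of_scaling (Function.update 1 0 c) (fun i => ?_) fun θ => ?_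
    · fin_cases i <;> simp [hc']
    · simp [level, dom, equation, inv, invNum, invDen, equationFn, hess_scaling]
      field_simp
      constructor <;> intro h <;> linarith
  | II =>
    have hc' := hc (.inr rfl)
    refine contactEquivalent_of_scaling (Function.update 1 1 c) (fun i => ?_) fun θ => ?_
    · fin_cases i <;> simp [hc']
    · simp [level, dom, equation, inv, invNum, invDen, equationFn, hess_scaling]
      rw [and_comm]
      refine and_congr_left fun h => ?_
      rw [div_eq_iff h]
      field_simp
      constructor <;> intro h <;> linarith
  | I => exact absurd rfl hτ

/-! Invariants and invariant equations. -/

lemma exists_mem_reg (τ : MAType) (θ : J1) : ∃ S, ((θ, S) : J2) ∈ reg τ := by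
  -- The value 2 at u₁₂ makes the denominator of type I equal to 2 - 1; all other conditions need
  -- only nonzero entries.
  refine ⟨fun e => if e = s(0, 1) then 2 else 1, ?_⟩
  cases τ with
  | O => exact mem_reg_O _
  | N => exact mem_reg_N _
  | D => exact mem_reg_D (by simp [hess])
  | III => exact mem_reg_III (by simp [hess])
  | II => exact mem_reg_II (by simp [hess]) (by simp [hess])
  | I => exact mem_reg_I (by simp [hess]; norm_num [Fin.ext_iff]) (by simp [hess])

lemma fderiv_inv_vertical {τ : MAType} {θ : J2} (hθ : θ ∈ dom τ) (v : J1) :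
    fderiv ℝ (inv τ) θ (v, 0) = 0 := by
  rw [fderiv_inv_eq_zero_iff hθ]
  cases τ <;> simp [numD, denD, hess]

/-- The contact fields with generating functions in the infinite part span the tangent spaces of `J¹`. -/
theorem eq_zero_of_contactField {τ : MAType} (hτ : τ ≠ .O) (θ : J1) (l : J1 →L[ℝ] ℝ)
    (hl : ∀ f ∈ sInf τ, l (contactField f θ) = 0) : l = 0 := by
  obtain ⟨S, hS⟩ := exists_mem_reg τ θ
  refine ContinuousLinearMap.ext fun v => ?_
  -- Pull l back to J² at a regular point above θ: the lift (v, 0) is in ker dI because I depends on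
  -- the uᵢⱼ alone.
  exact eq_zero_of_prolong hτ hS (l.comp (ContinuousLinearMap.fst ℝ _ _)) hl (v := (v, 0))
    (fderiv_inv_vertical hS.1 v)

theorem exists_const_of_isInvariant1 {τ : MAType} (hτ : τ ≠ .O) {U : Set J1} {J : J1 → ℝ}
    (hU : IsOpen U) (hU' : IsPreconnected U) (hJ : IsInvariant1 (sInf τ) U J) :
    ∃ c, ∀ θ ∈ U, J θ = c :=
  hU.exists_is_const_of_fderiv_eq_zero hU' (hJ.1.differentiableOn (by simp)) fun θ hθ =>
    eq_zero_of_contactField hτ θ _ fun f hf => hJ.2 f hf θ hθ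

theorem isInvariant1_base (i : Fin 4) :
    IsInvariant1 (sInf .O) Set.univ (fun θ => θ.1 i) := by
  refine ⟨by fun_prop, ?_⟩
  rintro f ⟨φ, hφ, rfl⟩ θ -
  have h := fderiv_comp_base (φ := fun x => x i) (by fun_prop) θ (contactField (fun θ => φ θ.1) θ)
  refine h.trans ?_
  have h0 : (contactField (fun θ => φ θ.1) θ).1 = 0 := by
    funext j
    exact prolong_comp_base_x hφ.1 (θ, 0) j
  rw [h0, map_zero]

theorem exists_factor_base {U : Set J1} {J : J1 → ℝ} (hU : IsOpen U)
    (hJ : IsInvariant1 (sInf .O) U J) {θ : J1} (hθ : θ ∈ U) :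
    ∃ F : (Fin 4 → ℝ) → ℝ, ContDiff ℝ ∞ F ∧ ∀ᶠ θ' in 𝓝 θ, J θ' = F θ'.1 := by
  refine exists_factor_linear (ContinuousLinearMap.fst ℝ (Fin 4 → ℝ) (ℝ × (Fin 4 → ℝ)))
    (ContinuousLinearMap.inl ℝ _ _) (fun c => rfl) hU hJ.1 (fun y hy v hv => ?_) hθ
  have hv' : v.1 = 0 := hv
  exact eq_zero_of_prolong_O ((fderiv ℝ J y).comp (ContinuousLinearMap.fst ℝ _ _)) (y, 0)
    (fun f hf => hJ.2 f hf y hy) (v := (v, 0)) (fun i => congrFun hv' i) (by simp [numD, hess])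

lemma isOpen_reg (τ : MAType) : IsOpen (reg τ) := by
  have h := ((contDiffOn_inv τ).continuousOn_fderiv_of_isOpen (isOpen_dom τ)
    (by simp)).isOpen_inter_preimage (isOpen_dom τ) (isOpen_ne (x := (0 : J2 →L[ℝ] ℝ)))
  exact h

theorem exists_factor_inv {τ : MAType} (hτ : τ ≠ .O) {U : Set J2} {J : J2 → ℝ} (hU : IsOpen U)
    (hJ : IsInvariant2 (sInf τ) U J) {θ : J2} (hθ : θ ∈ U ∩ reg τ) :
    ∃ F : ℝ → ℝ, ContDiff ℝ ∞ F ∧ ∀ᶠ θ' in 𝓝 θ, J θ' = F (inv τ θ') :=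
  exists_factor (hU.inter (isOpen_reg τ)) ((contDiffOn_inv τ).mono fun _ h => h.2.1)
    (hJ.1.mono Set.inter_subset_left)
    (fun x hx _ hv => eq_zero_of_prolong hτ hx.2 _ (fun f hf => hJ.2 f hf x hx.1) hv) hθ hθ.2.2

/-- The invariant of type O as a linear form. -/
def invO : J2 →L[ℝ] ℝ := hessL 0 0 - hessL 1 1 - hessL 2 2 - hessL 3 3

lemma invO_apply (θ : J2) : invO θ = inv .O θ := by
  simp [invO, inv, invNum, invDen, hessL_apply]

lemma numD_O_eq (θ v : J2) : numD .O θ v = invO v := rfl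

theorem exists_factor_inv_O {U : Set J2} {J : J2 → ℝ} (hU : IsOpen U)
    (hJ : IsInvariant2 (sInf .O) U J) {θ : J2} (hθ : θ ∈ U) :
    ∃ F : (Fin 4 → ℝ) × ℝ → ℝ, ContDiff ℝ ∞ F ∧ ∀ᶠ θ' in 𝓝 θ, J θ' = F (θ'.1.1, inv .O θ') := by
  let L : J2 →L[ℝ] (Fin 4 → ℝ) × ℝ := ((ContinuousLinearMap.fst ℝ _ _).comp
    (ContinuousLinearMap.fst ℝ _ _)).prod invO
  let R : (Fin 4 → ℝ) × ℝ →L[ℝ] J2 := ((ContinuousLinearMap.inl ℝ _ _).comp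
    (ContinuousLinearMap.inl ℝ _ _)).coprod (ContinuousLinearMap.toSpanSingleton ℝ (dS 0 0))
  have hLR : ∀ c, L (R c) = c := by
    intro c
    refine Prod.ext ?_ ?_
    · simp [L, R, dS]
    · simp [L, R, dS, invO, hessL_apply, hess]
  obtain ⟨F, hF, h⟩ := exists_factor_linear L R hLR hU hJ.1 (fun y hy v hv => by
    have h1 : v.1.1 = 0 := congrArg Prod.fst hv
    have h2 : invO v = 0 := congrArg Prod.snd hv
    exact eq_zero_of_prolong_O _ y (fun f hf => hJ.2 f hf y hy) (fun i => congrFun h1 i) h2) hθ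
  refine ⟨F, hF, ?_⟩
  filter_upwards [h] with θ' h'
  rw [h', ← invO_apply]
  rfl

theorem eventually_zero_iff_inv {τ : MAType} (hτ : τ ≠ .O) {U : Set J2} {G : J2 → ℝ} (hU : IsOpen U)
    (hG : IsInvariantEquation (sInf τ) U G) {θ : J2} (hθ : θ ∈ U ∩ reg τ) (h0 : G θ = 0) :
    ∀ᶠ θ' in 𝓝 θ, (G θ' = 0 ↔ inv τ θ' = inv τ θ) :=
  eventually_zero_iff_level (hU.inter (isOpen_reg τ)) ((contDiffOn_inv τ).mono fun _ h => h.2.1)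
    (hG.1.mono Set.inter_subset_left) (fun x hx hx0 => (hG.2 x hx.1 hx0).1)
    (fun x hx hx0 _ hv => eq_zero_of_prolong hτ hx.2 _ (hG.2 x hx.1 hx0).2 hv) hθ h0

/-- Types O, N, III have no critical points in `dom`. In types D and II the only critical value of I
is 0, and the equation is I = 1. In type I the only possible critical values are 0 and 1, and (α +
β)/β differs from both because α + β ≠ 0 and α ≠ 0. -/
lemma mem_reg_of_mem_equation {α β : ℝ} (hα : α ≠ 0) (hβ : β ≠ 0) (hαβ : α + β ≠ 0) {τ : MAType}
    {θ : J2} (h : θ ∈ equation α β τ ∩ dom τ) : θ ∈ reg τ := by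
  refine ⟨h.2, fun hzero => ?_⟩
  have hv : ∀ v, numD τ θ v * invDen τ θ - invNum τ θ * denD τ θ v = 0 := fun v =>
    (fderiv_inv_eq_zero_iff h.2 v).1 (by rw [hzero]; rfl)
  have hE : equationFn α β τ θ = 0 := h.1
  have hd : invDen τ θ ≠ 0 := h.2
  cases τ with
  | O => exact (mem_reg_O θ).2 hzero
  | N => exact (mem_reg_N θ).2 hzero
  | III => exact (mem_reg_III hd).2 hzero
  | D =>
    have h1 := hv (dS 0 3)
    have h2 := hv (dS 0 2)
    simp [numD, denD, invDen, dS, hess] at h1 h2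
    simp [equationFn, hess, h1, h2] at hE
  | II =>
    have h1 := hv (dS 0 2)
    have h2 := hv (dS 0 1)
    simp [invDen, hess] at hd
    simp [numD, denD, invDen, dS, hess, hd] at h1 h2
    simp [equationFn, hess, h1, h2] at hE
    exact hd hE
  | I =>
    simp only [invDen] at hd
    simp only [equationFn] at hE
    have h1 := hv (dS 0 2)
    have h3 := hv (dS 0 3)
    simp [numD, denD, invDen, invNum, dS] at h1 h3
    simp [hess] at h1 h3 hd hE
    have hq : θ.2 s(1, 3) = 0 := by tauto
    rw [hq, mul_zero, mul_zero, add_zero] at hE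
    rw [hq, mul_zero, sub_zero] at h3
    rcases h3 with h3 | h3
    · rw [h3, mul_zero, zero_sub, neg_eq_zero] at hE
      exact hd (by rw [h3, (mul_eq_zero.1 hE).resolve_left hαβ, sub_zero])
    · rw [h3, mul_zero, mul_zero, sub_zero] at hE
      exact hd (by rw [h3, mul_zero, (mul_eq_zero.1 hE).resolve_left hα, sub_zero])

lemma IsInvariantEquation.mono {s t : Set (J1 → ℝ)} (hst : s ⊆ t) {U : Set J2} {G : J2 → ℝ}
    (h : IsInvariantEquation t U G) : IsInvariantEquation s U G :=
  ⟨h.1, fun θ hθ h0 => ⟨(h.2 θ hθ h0).1, fun f hf => (h.2 θ hθ h0).2 f (hst hf)⟩⟩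

lemma IsRecoveredFrom.mono {E W : Set J2} {s t : Set (J1 → ℝ)} (hst : s ⊆ t)
    (h : IsRecoveredFrom E W s) : IsRecoveredFrom E W t :=
  fun U G hU hG => h U G hU (hG.mono hst)

theorem isRecoveredFrom_sInf {α β : ℝ} (hα : α ≠ 0) (hβ : β ≠ 0) (hαβ : α + β ≠ 0) {τ : MAType}
    (hτ : τ ≠ .O) : IsRecoveredFrom (equation α β τ) (dom τ) (sInf τ) := by
  intro U G hU hG θ hθ h0
  filter_upwards [eventually_zero_iff_inv hτ hU hG
    ⟨hθ.1, mem_reg_of_mem_equation hα hβ hαβ hθ.2⟩ h0, (isOpen_dom τ).mem_nhds hθ.2.2] with θ' h1 h2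
  rw [h1, (equationFn_eq_zero_iff hβ hθ.2.2).1 hθ.2.1]
  exact (equationFn_eq_zero_iff hβ h2).symm

/-- The generating function uᵢ gives the translation field -∂ᵢ, a symmetry of any equation with
constant coefficients. -/
lemma prolong_translation (i : Fin 4) (θ : J2) :
    prolong (fun θ => (Expr.P i).eval θ) θ = ((-Pi.single i 1, 0, 0), 0) := by
  have hD : ∀ j, dP j (fun θ => (Expr.P i).eval θ) θ.1 = (Pi.single j 1 : Fin 4 → ℝ) i :=
    fun j => Expr.dP_eval _ _ _
  refine Prod.ext (Prod.ext ?_ (Prod.ext ?_ ?_)) ?_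
  · funext j
    rw [prolong_x, hD]
    simp [Pi.single_apply, eq_comm]
  · rw [prolong_u]
    simp only [hD]
    simp [Pi.single_apply, Expr.P, Expr.eval_var, crd]
  · funext j
    rw [prolong_p]
    simp [Expr.P, Expr.der_var, Expr.eval_const]
  · funext s
    exact Expr.totalD2_eval _ _ _ _

lemma translation_mem_contactSymmetries (α β : ℝ) (i : Fin 4) :
    (fun θ => (Expr.P i).eval θ) ∈ contactSymmetries (equationFn α β .O) := by
  refine ⟨Expr.contDiff_eval _, fun θ _ => ?_⟩
  have h : equationFn α β .O = invNum .O := rfl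
  rw [h, fderiv_invNum, prolong_translation]
  simp [numD, hess]

theorem isRecoveredFrom_O (α β : ℝ) : IsRecoveredFrom (equation α β .O) (dom .O)
    (contactSymmetries (equationFn α β .O)) := by
  intro U G hU hG θ hθ h0
  have hfd : ∀ x, fderiv ℝ invO x = invO := fun x => invO.fderiv
  have h := eventually_zero_iff_level hU invO.contDiff.contDiffOn hG.1
    (fun x hx hx0 => (hG.2 x hx hx0).1) (fun x hx hx0 v hv => by
      rw [hfd] at hv
      have hS := (hG.2 x hx hx0).2
      -- A vector of ker dI is split into T, a combination of translations, and a vector without xⁱ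
      -- components, to which `eq_zero_of_prolong_O` applies.
      let T : J2 := ((v.1.1, 0, 0), 0)
      have hT : fderiv ℝ G x T = 0 := by
        have h1 : T = ∑ i, (-v.1.1 i) • (((-Pi.single i 1, 0, 0), 0) : J2) := by
          refine Prod.ext (Prod.ext ?_ (Prod.ext ?_ ?_)) ?_
          · funext j
            fin_cases j <;> simp [T, Fin.sum_univ_four]
          · simp [T, Fin.sum_univ_four]
          · simp [T, Fin.sum_univ_four]
          · simp [T, Fin.sum_univ_four]
        rw [h1, map_sum]
        refine Finset.sum_eq_zero fun i _ => ?_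
        rw [map_smul, ← prolong_translation i x, hS _ (translation_mem_contactSymmetries α β i),
          smul_zero]
      have h2 : fderiv ℝ G x (v - T) = 0 :=
        eq_zero_of_prolong_O _ x (fun f hf => hS f (sInf_subset_contactSymmetries α β .O hf))
          (fun i => by simp [T]) (by
            rw [numD_O_eq, map_sub, hv]
            simp [T, invO, hessL_apply, hess])
      rw [map_sub, hT, sub_zero] at h2
      exact h2) hθ.1 h0
  filter_upwards [h] with θ' h'
  have h3 : ∀ x, x ∈ equation α β .O ↔ invO x = 0 := fun x => Iff.rfl
  rw [h', h3, (h3 θ).1 hθ.2.1]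

end MongeAmpere

end

theorem theorem2 (α β : ℝ) (hα : α ≠ 0) (hβ : β ≠ 0) (hαβ : α + β ≠ 0) :
    -- no first order invariants
    (∀ τ, τ ≠ MongeAmpere.MAType.O → ∀ (U : Set MongeAmpere.J1) (J : MongeAmpere.J1 → ℝ),
      IsOpen U → IsPreconnected U → MongeAmpere.IsInvariant1 (MongeAmpere.sInf τ) U J →
      ∃ c, ∀ θ ∈ U, J θ = c) ∧
    (∀ i, MongeAmpere.IsInvariant1 (MongeAmpere.sInf .O) Set.univ (fun θ => θ.1 i)) ∧
    (∀ (U : Set MongeAmpere.J1) (J : MongeAmpere.J1 → ℝ),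
      IsOpen U → MongeAmpere.IsInvariant1 (MongeAmpere.sInf .O) U J →
      ∀ θ ∈ U, ∃ F : (Fin 4 → ℝ) → ℝ, ContDiff ℝ ∞ F ∧ ∀ᶠ θ' in 𝓝 θ, J θ' = F θ'.1) ∧
    -- the second order invariant
    (∀ τ, MongeAmpere.IsInvariant2 (MongeAmpere.sInf τ) (MongeAmpere.dom τ) (MongeAmpere.inv τ) ∧
      Dense (MongeAmpere.reg τ)) ∧
    -- it is the only one up to gauge
    (∀ τ, τ ≠ MongeAmpere.MAType.O → ∀ (U : Set MongeAmpere.J2) (J : MongeAmpere.J2 → ℝ),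
      IsOpen U → MongeAmpere.IsInvariant2 (MongeAmpere.sInf τ) U J →
      ∀ θ ∈ U ∩ MongeAmpere.reg τ, ∃ F : ℝ → ℝ, ContDiff ℝ ∞ F ∧
        ∀ᶠ θ' in 𝓝 θ, J θ' = F (MongeAmpere.inv τ θ')) ∧
    (∀ (U : Set MongeAmpere.J2) (J : MongeAmpere.J2 → ℝ),
      IsOpen U → MongeAmpere.IsInvariant2 (MongeAmpere.sInf .O) U J →
      ∀ θ ∈ U, ∃ F : (Fin 4 → ℝ) × ℝ → ℝ, ContDiff ℝ ∞ F ∧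
        ∀ᶠ θ' in 𝓝 θ, J θ' = F (θ'.1.1, MongeAmpere.inv .O θ')) ∧
    -- every equation invariant under the infinite part is locally a level set of the invariant
    (∀ τ, τ ≠ MongeAmpere.MAType.O → ∀ (U : Set MongeAmpere.J2) (G : MongeAmpere.J2 → ℝ),
      IsOpen U → MongeAmpere.IsInvariantEquation (MongeAmpere.sInf τ) U G →
      ∀ θ ∈ U ∩ MongeAmpere.reg τ, G θ = 0 →
        ∀ᶠ θ' in 𝓝 θ, (G θ' = 0 ↔ MongeAmpere.inv τ θ' = MongeAmpere.inv τ θ)) ∧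
    -- the level sets are the equations, up to equivalence
    (∀ τ, τ ≠ MongeAmpere.MAType.I → ∀ c : ℝ,
      ((τ = MongeAmpere.MAType.D ∨ τ = MongeAmpere.MAType.II) → c ≠ 0) →
      MongeAmpere.ContactEquivalent (MongeAmpere.level τ c)
        (MongeAmpere.equation α β τ ∩ MongeAmpere.dom τ)) ∧
    MongeAmpere.level .I ((α + β) / β) = MongeAmpere.equation α β .I ∩ MongeAmpere.dom .I ∧
    -- Lie remarkable property
    (∀ τ, MongeAmpere.sInf τ ⊆ MongeAmpere.contactSymmetries (MongeAmpere.equationFn α β τ) ∧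
      MongeAmpere.equation α β τ ⊆ closure (MongeAmpere.equation α β τ ∩ MongeAmpere.dom τ) ∧
      MongeAmpere.IsRecoveredFrom (MongeAmpere.equation α β τ) (MongeAmpere.dom τ)
        (MongeAmpere.contactSymmetries (MongeAmpere.equationFn α β τ))) ∧
    (∀ τ, τ ≠ MongeAmpere.MAType.O →
      MongeAmpere.IsRecoveredFrom (MongeAmpere.equation α β τ) (MongeAmpere.dom τ)
        (MongeAmpere.sInf τ)) := by
  refine ⟨fun τ hτ U J hU hU' hJ => MongeAmpere.exists_const_of_isInvariant1 hτ hU hU' hJ,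
    MongeAmpere.isInvariant1_base,
    fun U J hU hJ θ hθ => MongeAmpere.exists_factor_base hU hJ hθ,
    fun τ => ⟨MongeAmpere.isInvariant2_inv τ, MongeAmpere.dense_reg τ⟩,
    fun τ hτ U J hU hJ θ hθ => MongeAmpere.exists_factor_inv hτ hU hJ hθ,
    fun U J hU hJ θ hθ => MongeAmpere.exists_factor_inv_O hU hJ hθ,
    fun τ hτ U G hU hG θ hθ h0 => MongeAmpere.eventually_zero_iff_inv hτ hU hG hθ h0,
    fun τ hτ c hc => MongeAmpere.contactEquivalent_level α β hτ c hc,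
    MongeAmpere.level_I_eq hβ,
    fun τ => ⟨MongeAmpere.sInf_subset_contactSymmetries α β τ,
      MongeAmpere.equation_subset_closure α β hβ τ, ?_⟩,
    fun τ hτ => MongeAmpere.isRecoveredFrom_sInf hα hβ hαβ hτ⟩
  rcases eq_or_ne τ .O with rfl | hτ
  · exact MongeAmpere.isRecoveredFrom_O α β
  -- A larger algebra has fewer invariant equations, so recovery from `sInf` implies recovery from
  -- all contact symmetries.
  · exact (MongeAmpere.isRecoveredFrom_sInf hα hβ hαβ hτ).mono
      (MongeAmpere.sInf_subset_contactSymmetries α β τ)
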